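/- Let $p$ be a prime, $F$ a field of characteristic $p$, and $G$ a group. Write $FG$ for the group algebra, $V(FG)$ for the group of units of $FG$ of augmentation $1$, $\mathfrak I(N)$ for the two-sided ideal of $FG$ generated by all $h-1$ with $h\in N$ (for a normal subgroup $N\le G$), $G'$ for the commutator subgroup, $V'$ for that of $V(FG)$, and $\mathfrak t(G)$ for the set of elements of finite order of $G$. A Sylow $q$-subgroup is a maximal $q$-subgroup. A group is Engel if for all elements $x,y$ some left-normed commutator $(x,y,\ldots,y)$ equals $1$, the number of entries $y$ depending on $x$ and $y$. Suppose that $G'$ is a locally finite $p$-group, that the Sylow $p$-subgroup $P$ of $G$ is normal in $G$, and that $V(FG)$ is an Engel group. Then: (i) $V'\le 1+\mathfrak I(G')$, and $1+\mathfrak I(P)$ is a subgroup of $V(FG)$ and is the unique Sylow $p$-subgroup of $V(FG)$. (ii) For each prime $q\ne p$ the group $G$ has a unique Sylow $q$-subgroup $\mathrm{Syl}_q(G)$, and it is central in $G$. (iii) $\mathfrak t(G)$ is a normal subgroup of $G$ and $\mathfrak t(G)=P\times D$ (internal direct product), where $D=\prod_{q\ne p}\mathrm{Syl}_q(G)$ is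 the internal (restricted) direct product over all primes $q\neq p$. (iv) Let $M$ be the subgroup of $G/P$ generated by $DP/P$ and by all elements of infinite order of $G/P$. Then $V(FG)/(1+\mathfrak I(P))\cong V(FM)$. The map $D\to M$, $d\mapsto dP$, embeds $V(FD)$ into $V(FM)$ as a normal subgroup, and $V(FM)/V(FD)$ is torsion-free. (v) $G/\mathfrak t(G)$ is a torsion-free abelian group. If $D$ is finite, then $FD$ is a direct sum of finitely many fields, and $$V(FM)\cong V(FD)\times\underbrace{G/\mathfrak t(G)\times\cdots\times G/\mathfrak t(G)}_{n},$$ where $n$ is the number of summands in a decomposition of $FD$ into a direct sum of fields. -/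

import Mathlib

noncomputable section

/-- The left-normed commutator `(x, y, …, y)` with `n` entries `y`, where
`(a, b) = a⁻¹ b⁻¹ a b`. -/
def engelWord {G : Type*} [Group G] (x y : G) : ℕ → G
  | 0 => x
  | n + 1 => (engelWord x y n)⁻¹ * y⁻¹ * engelWord x y n * y

/-- A group is Engel if for all `x, y` some commutator `(x, y, …, y)` is trivial; the number of
entries may depend on `x` and `y`. -/
def IsEngelGroup (G : Type*) [Group G] : Prop :=
  ∀ x y : G, ∃ n : ℕ, engelWord x y n = 1

/-- A group is locally finite if all its finitely generated subgroups are finite. -/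
def IsLocallyFiniteGroup (G : Type*) [Group G] : Prop :=
  ∀ H : Subgroup G, H.FG → Finite H

/-- A group is torsion-free if the identity is its only element of finite order. -/
def IsTorsionFreeGroup (G : Type*) [Group G] : Prop :=
  ∀ x : G, IsOfFinOrder x → x = 1

/-- The ring `R` decomposes as a direct sum of `n` fields. -/
def IsDirectSumOfFields.{w} (R : Type w) [Ring R] (n : ℕ) : Prop :=
  ∃ (K : Fin n → Type w) (_ : ∀ i, Field (K i)), Nonempty (R ≃+* (∀ i, K i))

section GroupAlgebra

variable (F : Type*) [Field F] {G H : Type*} [Group G] [Group H]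

/-- The augmentation `∑ a_g g ↦ ∑ a_g` of the group algebra `FG`. -/
def augmentationHom (G : Type*) [Group G] : MonoidAlgebra F G →ₐ[F] F :=
  MonoidAlgebra.lift F F G 1

/-- The group `V(FG)` of normalized units: the units of `FG` of augmentation `1`. -/
def normalizedUnits (G : Type*) [Group G] : Subgroup (MonoidAlgebra F G)ˣ :=
  (Units.map (augmentationHom F G : MonoidAlgebra F G →* F)).ker

/-- The ring homomorphism `FG → FH` induced by a group homomorphism `G → H`. -/
def groupAlgebraMap (f : G →* H) : MonoidAlgebra F G →ₐ[F] MonoidAlgebra F H :=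
  MonoidAlgebra.mapDomainAlgHom F F f

theorem augmentationHom_groupAlgebraMap (f : G →* H) (x : MonoidAlgebra F G) :
    augmentationHom F H (groupAlgebraMap F f x) = augmentationHom F G x := by
  have h : (augmentationHom F H).comp (groupAlgebraMap F f) = augmentationHom F G := by
    apply MonoidAlgebra.algHom_ext'
    · ext g
      simp [augmentationHom, groupAlgebraMap]
    · exact Subsingleton.elim _ _
  exact DFunLike.congr_fun h x

/-- The group homomorphism `V(FG) → V(FH)` induced by a group homomorphism `G → H`. -/
def normalizedUnitsMap (f : G →* H) : normalizedUnits F G →* normalizedUnits F H :=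
  ((Units.map (groupAlgebraMap F f : MonoidAlgebra F G →* MonoidAlgebra F H)).comp
    (normalizedUnits F G).subtype).codRestrict (normalizedUnits F H) (by
      intro u
      have hu : augmentationHom F G ((u : (MonoidAlgebra F G)ˣ) : MonoidAlgebra F G) = 1 :=
        congrArg Units.val (MonoidHom.mem_ker.1 u.2)
      refine MonoidHom.mem_ker.2 (Units.ext ?_)
      exact (augmentationHom_groupAlgebraMap F f _).trans hu)

/-- `𝔍(N)`: the two-sided ideal of `FG` generated by all `h - 1` with `h ∈ N`. -/
def subgroupIdeal (N : Subgroup G) : TwoSidedIdeal (MonoidAlgebra F G) :=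
  TwoSidedIdeal.span {x | ∃ h ∈ N, x = MonoidAlgebra.of F G h - 1}

variable {F}

/-- For a two-sided ideal `I` of `FG`, the subgroup of all `u ∈ V(FG)` that lie in `1 + I`. -/
def onePlus (I : TwoSidedIdeal (MonoidAlgebra F G)) : Subgroup (normalizedUnits F G) where
  carrier := {u | ((u : (MonoidAlgebra F G)ˣ) : MonoidAlgebra F G) - 1 ∈ I}
  one_mem' := by simp [I.zero_mem]
  mul_mem' := by
    intro a b ha hb
    have h := I.add_mem (I.mul_mem_right _ ((b : (MonoidAlgebra F G)ˣ) : MonoidAlgebra F G) ha) hb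
    have e : ((a : (MonoidAlgebra F G)ˣ) - 1 : MonoidAlgebra F G) * (b : (MonoidAlgebra F G)ˣ)
        + ((b : (MonoidAlgebra F G)ˣ) - 1)
        = ((a * b : normalizedUnits F G) : (MonoidAlgebra F G)ˣ) - 1 := by
      push_cast; noncomm_ring
    rw [e] at h
    exact h
  inv_mem' := by
    intro a ha
    have h := I.neg_mem
      (I.mul_mem_left (((a : (MonoidAlgebra F G)ˣ)⁻¹ : (MonoidAlgebra F G)ˣ) :
        MonoidAlgebra F G) _ ha)
    rw [mul_sub, Units.inv_mul, mul_one, neg_sub] at h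
    exact h

instance onePlus_normal (I : TwoSidedIdeal (MonoidAlgebra F G)) : (onePlus I).Normal where
  conj_mem := by
    intro a ha g
    have h := I.mul_mem_right _
      (((g : (MonoidAlgebra F G)ˣ)⁻¹ : (MonoidAlgebra F G)ˣ) : MonoidAlgebra F G)
      (I.mul_mem_left ((g : (MonoidAlgebra F G)ˣ) : MonoidAlgebra F G) _ ha)
    rw [mul_sub, mul_one, sub_mul, Units.mul_inv] at h
    exact h

end GroupAlgebra

section SylowParts

/-- The subgroup generated by all Sylow `q`-subgroups of `G`; it is the Sylow `q`-subgroup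
as soon as there is only one. -/
def syl (q : ℕ) (G : Type*) [Group G] : Subgroup G :=
  ⨆ Q : Sylow q G, (Q : Subgroup G)

/-- The subgroup `D` generated by the Sylow `q`-subgroups for all primes `q ≠ p`. -/
def primeToPart (p : ℕ) (G : Type*) [Group G] : Subgroup G :=
  ⨆ q : {q : ℕ // q.Prime ∧ q ≠ p}, syl q G

variable (p : ℕ) {G : Type*} [Group G] (P : Subgroup G) [P.Normal]

/-- The subgroup `M` of `G/P` generated by `DP/P` and by all elements of infinite order. -/
def subgroupM : Subgroup (G ⧸ P) :=
  Subgroup.closure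
    (((primeToPart p G).map (QuotientGroup.mk' P) : Set (G ⧸ P)) ∪ {x | ¬ IsOfFinOrder x})

/-- The homomorphism `D → M`, `d ↦ dP`, through which `D ≅ DP/P` is regarded as a subgroup
of `M`. -/
def primeToPartHom : primeToPart p G →* subgroupM p P :=
  ((QuotientGroup.mk' P).comp (primeToPart p G).subtype).codRestrict (subgroupM p P)
    (fun d => Subgroup.subset_closure (Or.inl ⟨d, d.2, rfl⟩))

end SylowParts

end

/-!
The Engel condition on `V(FG)` is used only through its subgroup `G`, and it has two consequences.
First, elements of order prime to `p` are central (`mem_center_of_coprime`): in a sequence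
`x, (x, g), (x, g, g), …` ending in `1`, the last nontrivial commutator would be both a `p`-element
and killed by the order of `g`. This gives the Sylow subgroups for `q ≠ p`, the central subgroup
`D`, and the decomposition of the torsion part of `G` as `P × D`. Second, a finite subset of `P` lies
in a finite subgroup `K` of `P` normalized by any prescribed finite set of elements
(`exists_finite_le_normalized`). As the augmentation ideal of a finite `p`-group in characteristic
`p` is nilpotent (`exists_augSpan_pow_eq_bot`), the ideal `𝔍(P)` is nil
(`isNilpotent_of_mem_subgroupIdeal`), so `1 + 𝔍(P)` is a `p`-group of units and `V(FG)` maps onto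
`V(F[G/P])` with this kernel.

What remains concerns `M = G/P`, an abelian group without `p`-torsion whose torsion subgroup is the
image of `D`. The algebra `FM` is reduced (`isReduced_monoidAlgebra`), so `V(FM)` has no
`p`-torsion and `1 + 𝔍(P)` contains every `p`-subgroup of `V(FG)`. Grading `FM` by the torsion-free
group `M/D` and reducing modulo the prime ideals of `FM` turns units into trivial units `c a`, where
`a` is an element of `M/D`; hence a unit with a power in `FD` lies in `FD`, that is,
`V(FM)/V(FD)` is torsion-free.

If `D` is finite, it is a direct factor of `M` because it is a pure subgroup of bounded exponent
(`exists_retraction`, by extending characters to the divisible group `ℚ/ℤ`). Then, with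
`FD ≅ ∏ K_i` and `A = M/D`, one has `FM ≅ (FD)[A] ≅ ∏ K_i[A]`, and a unit of `K_i[A]` is a scalar
times an element of `A`; the scalars make up `V(FD)` and the elements of `A` make up
`A × ⋯ × A` (`nonempty_normalizedUnits_prod_equiv`).
-/

/-! ### Engel words and Engel groups -/

theorem conj_engelWord {G : Type*} [Group G] (x y : G) (n : ℕ) :
    y⁻¹ * engelWord x y n * y = engelWord x y n * engelWord x y (n + 1) := by
  simp [engelWord, mul_assoc]

theorem map_engelWord {G H : Type*} [Group G] [Group H] (f : G →* H) (x y : G) (n : ℕ) :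
    f (engelWord x y n) = engelWord (f x) (f y) n := by
  induction n with
  | zero => rfl
  | succ n ih => simp [engelWord, ih]

theorem IsEngelGroup.of_injective {G H : Type*} [Group G] [Group H] (hH : IsEngelGroup H)
    (f : G →* H) (hf : Function.Injective f) : IsEngelGroup G := by
  intro x y
  obtain ⟨n, hn⟩ := hH (f x) (f y)
  exact ⟨n, hf (by rw [map_engelWord, hn, map_one])⟩

theorem engelWord_mem_of_normal {G : Type*} [Group G] {N : Subgroup G} [hN : N.Normal] {x : G}
    (hx : x ∈ N) (y : G) (n : ℕ) : engelWord x y n ∈ N := by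
  induction n with
  | zero => exact hx
  | succ n ih =>
    have h := N.mul_mem (N.inv_mem ih) (hN.conj_mem _ ih y⁻¹)
    simpa [engelWord, mul_assoc] using h

theorem engelWord_succ_mem_commutator {G : Type*} [Group G] (x y : G) (n : ℕ) :
    engelWord x y (n + 1) ∈ commutator G := by
  have h := Subgroup.commutator_mem_commutator
    (Subgroup.mem_top (engelWord x y n)⁻¹) (Subgroup.mem_top y⁻¹)
  simpa [commutatorElement_def, engelWord, commutator_def] using h

/-- In an Engel group whose commutator subgroup is a `p`-group, elements of order prime to `p` are
central: if `c = (x, g, …, g)` is the last nontrivial commutator and `b` the one before it, then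
`g` centralizes `c = b⁻¹ (g⁻¹ b g)`, so conjugation by `g ^ m = 1` takes `b` to `b * c ^ m`. Hence
`c ^ m = 1`, and as `c` is a `p`-element and `m` is prime to `p`, this forces `c = 1`. -/
theorem mem_center_of_coprime {G : Type*} [Group G] {p : ℕ} [Fact p.Prime]
    (hE : IsEngelGroup G) (hp : IsPGroup p (commutator G)) {g : G} {m : ℕ}
    (hgm : g ^ m = 1) (hm : m.Coprime p) : g ∈ Subgroup.center G := by
  have step : ∀ (x : G) (n : ℕ), engelWord x g (n + 2) = 1 → engelWord x g (n + 1) = 1 := by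
    intro x n h
    set b := engelWord x g n with hb
    set c := engelWord x g (n + 1) with hc
    have h1 : g⁻¹ * b * g = b * c := conj_engelWord x g n
    have h2 : g⁻¹ * c * g = c := by
      have := conj_engelWord x g (n + 1)
      rwa [h, mul_one] at this
    have hk : ∀ k : ℕ, (g ^ k)⁻¹ * b * g ^ k = b * c ^ k := by
      intro k
      induction k with
      | zero => simp
      | succ k ih =>
        have e : (g ^ (k + 1))⁻¹ * b * g ^ (k + 1) = g⁻¹ * ((g ^ k)⁻¹ * b * g ^ k) * g := by
          rw [pow_succ]; group
        have h3 : g⁻¹ * c ^ k * g = c ^ k := by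
          have := conj_pow (i := k) (a := g⁻¹) (b := c)
          simp only [inv_inv] at this
          rw [← this, h2]
        rw [e, ih, show g⁻¹ * (b * c ^ k) * g = (g⁻¹ * b * g) * (g⁻¹ * c ^ k * g) by group, h1, h3,
          pow_succ', mul_assoc]
    have hcm : c ^ m = 1 := by
      have := hk m
      rw [hgm] at this
      simpa using this
    obtain ⟨k, hck⟩ := hp ⟨c, engelWord_succ_mem_commutator x g n⟩
    have hck' : c ^ p ^ k = 1 := congrArg Subtype.val hck
    have h := pow_gcd_eq_one.2 ⟨hcm, hck'⟩
    rwa [Nat.Coprime.pow_right k hm, pow_one] at h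
  rw [Subgroup.mem_center_iff]
  intro x
  obtain ⟨n, hn⟩ := hE x g
  have h1 : engelWord x g 1 = 1 := by
    have hn' : engelWord x g (n + 1) = 1 := by simp [engelWord, hn]
    clear hn
    induction n with
    | zero => exact hn'
    | succ n ih => exact ih (step x n hn')
  have h2 := conj_engelWord x g 0
  rw [h1, mul_one] at h2
  simp only [engelWord] at h2
  calc x * g = g * (g⁻¹ * x * g) := by group
    _ = g * x := by rw [h2]

/-! ### Finite subgroups of a locally finite normal subgroup of an Engel group -/

theorem mem_normalizer_of_finite {G : Type*} [Group G] {K : Subgroup G} [Finite K] {g : G}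
    (h : ∀ a ∈ K, g * a * g⁻¹ ∈ K) : g ∈ Subgroup.normalizer (K : Set G) := by
  have hfin : (K : Set G).Finite := Set.toFinite _
  have hinj : Set.InjOn (fun a => g * a * g⁻¹) (K : Set G) := by
    intro a _ b _ hab
    simpa using hab
  have hsurj : Set.SurjOn (fun a => g * a * g⁻¹) (K : Set G) K :=
    (Set.eq_of_subset_of_ncard_le (Set.image_subset_iff.2 h) hinj.ncard_image.ge hfin).ge
  rw [Subgroup.mem_normalizer_iff]
  refine fun a => ⟨h a, fun ha => ?_⟩
  obtain ⟨b, hb, hba⟩ := hsurj ha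
  have : b = a := by simpa using hba
  exact this ▸ hb

theorem exists_finite_le_conj_invariant {G : Type*} [Group G] (hE : IsEngelGroup G)
    {P : Subgroup G} [P.Normal]
    (hP : ∀ S : Set G, S.Finite → S ⊆ P → Finite (Subgroup.closure S))
    {C : Set G} (hC : C.Finite) (hCP : C ⊆ P) (g : G) :
    ∃ L : Subgroup G, Finite L ∧ C ⊆ L ∧ L ≤ P ∧ ∀ a ∈ L, g⁻¹ * a * g ∈ L := by
  choose n hn using fun a => hE a g
  -- The words `(a, g, …, g)` with `a ∈ C` generate a subgroup invariant under conjugation by `g`,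
  -- because `w_i ^ g = w_i * w_{i+1}`.
  let S : Set G := ⋃ a ∈ C, (fun i => engelWord a g i) '' Set.Iic (n a)
  have hS : S.Finite := hC.biUnion fun a _ => (Set.finite_Iic _).image _
  have hSP : S ⊆ P := by
    intro x hx
    simp only [S, Set.mem_iUnion] at hx
    obtain ⟨a, ha, i, -, rfl⟩ := hx
    exact engelWord_mem_of_normal (hCP ha) g i
  refine ⟨Subgroup.closure S, hP S hS hSP, ?_, (Subgroup.closure_le _).2 hSP, ?_⟩
  · intro a ha
    exact Subgroup.subset_closure (Set.mem_biUnion ha ⟨0, by simp, rfl⟩)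
  · intro a ha
    induction ha using Subgroup.closure_induction with
    | mem x hx =>
      simp only [S, Set.mem_iUnion] at hx
      obtain ⟨a, ha, i, hi, rfl⟩ := hx
      simp only [conj_engelWord]
      refine Subgroup.mul_mem _ (Subgroup.subset_closure (Set.mem_biUnion ha ⟨i, hi, rfl⟩)) ?_
      rcases (Set.mem_Iic.1 hi).lt_or_eq with h | rfl
      · exact Subgroup.subset_closure (Set.mem_biUnion ha ⟨i + 1, h, rfl⟩)
      · simp [engelWord, hn]
    | one => simp
    | mul x y _ _ hx hy =>
      have := Subgroup.mul_mem _ hx hy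
      simpa [mul_assoc] using this
    | inv x _ hx =>
      have := Subgroup.inv_mem _ hx
      simpa [mul_assoc] using this

/-- In an Engel group, a finite subset of a locally finite normal subgroup `P` containing the
commutator subgroup lies in a finite subgroup of `P` normalized by any prescribed finite set. -/
theorem exists_finite_le_normalized {G : Type*} [Group G] (hE : IsEngelGroup G)
    {P : Subgroup G} [P.Normal] (hGP : commutator G ≤ P)
    (hP : ∀ S : Set G, S.Finite → S ⊆ P → Finite (Subgroup.closure S)) (T : Finset G) :
    ∀ {C : Set G}, C.Finite → C ⊆ P →
      ∃ K : Subgroup G, Finite K ∧ C ⊆ K ∧ K ≤ P ∧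
        ∀ s ∈ T, s ∈ Subgroup.normalizer (K : Set G) := by
  classical
  induction T using Finset.induction_on with
  | empty =>
    intro C hC hCP
    exact ⟨Subgroup.closure C, hP C hC hCP, Subgroup.subset_closure, (Subgroup.closure_le _).2 hCP,
      by simp⟩
  | insert g T _ ih =>
    intro C hC hCP
    obtain ⟨K₁, hK₁, hCK₁, hK₁P, hTK₁⟩ := ih (C := C ∪ (fun s => g * s * g⁻¹ * s⁻¹) '' (T : Set G))
      (hC.union (T.finite_toSet.image _)) (by
        refine Set.union_subset hCP ?_
        rintro _ ⟨s, -, rfl⟩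
        exact hGP (Subgroup.commutator_mem_commutator (Subgroup.mem_top g) (Subgroup.mem_top s)))
    obtain ⟨L, hL, hK₁L, hLP, hgL⟩ := exists_finite_le_conj_invariant hE hP
      (Set.toFinite (K₁ : Set G)) hK₁P g
    have hgLk : ∀ (k : ℕ), ∀ a ∈ L, (g ^ k)⁻¹ * a * g ^ k ∈ L := by
      intro k
      induction k with
      | zero => simp
      | succ k ihk =>
        intro a ha
        have := hgL _ (ihk a ha)
        rwa [show g⁻¹ * ((g ^ k)⁻¹ * a * g ^ k) * g = (g ^ (k + 1))⁻¹ * a * g ^ (k + 1) by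
          rw [pow_succ]; group] at this
    let S : Set G := {x | ∃ a ∈ K₁, ∃ k : ℕ, x = (g ^ k)⁻¹ * a * g ^ k}
    let K₂ := Subgroup.closure S
    have hK₂L : K₂ ≤ L := by
      refine (Subgroup.closure_le _).2 ?_
      rintro _ ⟨a, ha, k, rfl⟩
      exact hgLk k a (hK₁L ha)
    have hK₁₂ : K₁ ≤ K₂ := fun a ha => Subgroup.subset_closure ⟨a, ha, 0, by simp⟩
    have hK₂ : Finite K₂ := Finite.of_injective _ (Subgroup.inclusion_injective hK₂L)
    have conj_gen : ∀ t : G, (∀ a ∈ S, t * a * t⁻¹ ∈ K₂) →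
        t ∈ Subgroup.normalizer (K₂ : Set G) := by
      intro t ht
      refine mem_normalizer_of_finite fun a ha => ?_
      induction ha using Subgroup.closure_induction with
      | mem x hx => exact ht x hx
      | one => simp
      | mul x y _ _ hx hy =>
        have := Subgroup.mul_mem _ hx hy
        simpa [mul_assoc] using this
      | inv x _ hx =>
        have := Subgroup.inv_mem _ hx
        simpa [mul_assoc] using this
    have hg : g ∈ Subgroup.normalizer (K₂ : Set G) := by
      have : g⁻¹ ∈ Subgroup.normalizer (K₂ : Set G) := by
        refine conj_gen _ ?_
        rintro _ ⟨a, ha, k, rfl⟩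
        refine Subgroup.subset_closure ⟨a, ha, k + 1, ?_⟩
        rw [pow_succ]; group
      simpa using Subgroup.inv_mem _ this
    refine ⟨K₂, hK₂, fun a ha => hK₁₂ (hCK₁ (Or.inl ha)), hK₂L.trans hLP, ?_⟩
    intro s hs
    rcases Finset.mem_insert.1 hs with rfl | hs
    · exact hg
    · -- `c k = (g ^ k, s)` lies in `K₂`, by induction from `(g, s) ∈ K₁`.
      have hc : ∀ k : ℕ, g ^ k * s * (g ^ k)⁻¹ * s⁻¹ ∈ K₂ := by
        intro k
        induction k with
        | zero => simp
        | succ k ihk =>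
          have h1 := (Subgroup.mem_normalizer_iff.1 hg _).1 ihk
          have h2 : g * s * g⁻¹ * s⁻¹ ∈ K₂ := hK₁₂ (hCK₁ (Or.inr ⟨s, hs, rfl⟩))
          have := Subgroup.mul_mem _ h1 h2
          rwa [show g * (g ^ k * s * (g ^ k)⁻¹ * s⁻¹) * g⁻¹ * (g * s * g⁻¹ * s⁻¹) =
            g ^ (k + 1) * s * (g ^ (k + 1))⁻¹ * s⁻¹ by rw [pow_succ']; group] at this
      refine conj_gen s ?_
      rintro _ ⟨a, ha, k, rfl⟩
      have h1 : s * a * s⁻¹ ∈ K₂ := hK₁₂ ((Subgroup.mem_normalizer_iff.1 (hTK₁ s hs) a).1 ha)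
      have h2 := Subgroup.mul_mem _ (Subgroup.mul_mem _ (hc k) h1) (Subgroup.inv_mem _ (hc k))
      have hgk : (g ^ k)⁻¹ ∈ Subgroup.normalizer (K₂ : Set G) :=
        Subgroup.inv_mem _ (Subgroup.pow_mem _ hg k)
      have h3 := (Subgroup.mem_normalizer_iff.1 hgk _).1 h2
      have e : (g ^ k)⁻¹ * (g ^ k * s * (g ^ k)⁻¹ * s⁻¹ * (s * a * s⁻¹) *
          (g ^ k * s * (g ^ k)⁻¹ * s⁻¹)⁻¹) * ((g ^ k)⁻¹)⁻¹ =
          s * ((g ^ k)⁻¹ * a * g ^ k) * s⁻¹ := by group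
      rwa [e] at h3

/-- A torsion group extending an abelian group by a locally finite one is locally finite. -/
theorem finite_closure_of_commutator_le {G : Type*} [Group G]
    (hG' : IsLocallyFiniteGroup (commutator G)) {P : Subgroup G}
    (hP : ∀ x ∈ P, IsOfFinOrder x) {S : Set G} (hS : S.Finite) (hSP : S ⊆ P) :
    Finite (Subgroup.closure S) := by
  set H := Subgroup.closure S with hH
  have hHP : H ≤ P := (Subgroup.closure_le _).2 hSP
  have hfgH : H.FG := (Subgroup.fg_iff H).2 ⟨S, rfl, hS⟩
  have : Group.FG H := (Group.fg_iff_subgroup_fg H).2 hfgH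
  let N : Subgroup H := (commutator G).subgroupOf H
  have hcomm : ∀ a b : H ⧸ N, a * b = b * a := by
    intro a b
    induction a using QuotientGroup.induction_on with | _ a => ?_
    induction b using QuotientGroup.induction_on with | _ b => ?_
    rw [← QuotientGroup.mk_mul, ← QuotientGroup.mk_mul, QuotientGroup.eq]
    have := Subgroup.commutator_mem_commutator
      (Subgroup.mem_top (b : G)⁻¹) (Subgroup.mem_top (a : G)⁻¹)
    simpa [N, Subgroup.mem_subgroupOf, commutatorElement_def, mul_assoc, commutator_def] using this
  let _ : CommGroup (H ⧸ N) := { (inferInstance : Group (H ⧸ N)) with mul_comm := hcomm }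
  have hfinq : Finite (H ⧸ N) := by
    have : Group.FG (H ⧸ N) := QuotientGroup.fg N
    refine CommGroup.finite_of_fg_isMulTorsion _ ?_
    intro a
    induction a using QuotientGroup.induction_on with | _ a => ?_
    exact (QuotientGroup.mk' N).isOfFinOrder
      ((Submonoid.isOfFinOrder_coe).1 (hP _ (hHP a.2)))
  have hidx : N.FiniteIndex := Subgroup.finiteIndex_of_finite_quotient
  have hNfg : Group.FG N := Subgroup.fg_of_index_ne_zero N
  have hNfin : Finite N := by
    let φ : N →* commutator G :=
      (H.subtype.comp N.subtype).codRestrict (commutator G) (fun x => x.2)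
    have hφ : Function.Injective φ := by
      intro x y hxy
      exact Subtype.ext (Subtype.ext (congrArg (fun z : commutator G => (z : G)) hxy))
    have hr : φ.range.FG := (Group.fg_iff_subgroup_fg _).1 inferInstance
    have := hG' _ hr
    exact Finite.of_injective φ.rangeRestrict (fun x y h => hφ (Subtype.ext_iff.1 h))
  exact Finite.of_subgroup_quotient N

/-! ### Sylow subgroups and the torsion part -/

theorem IsPGroup.le_of_normal_sylow {G : Type*} [Group G] {p : ℕ} {P : Sylow p G}
    [(P : Subgroup G).Normal] {Q : Subgroup G} (hQ : IsPGroup p Q) : Q ≤ P := by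
  have h := P.is_maximal' (P.isPGroup'.to_sup_of_normal_left hQ) le_sup_left
  exact le_sup_right.trans h.le

theorem mem_sylow_of_pow_eq_one {G : Type*} [Group G] {p : ℕ} {P : Sylow p G}
    [(P : Subgroup G).Normal] {g : G} {k : ℕ} (hg : g ^ p ^ k = 1) : g ∈ P := by
  refine IsPGroup.le_of_normal_sylow (Q := Subgroup.zpowers g) ?_ (Subgroup.mem_zpowers g)
  rintro ⟨x, hx⟩
  obtain ⟨n, rfl⟩ := Subgroup.mem_zpowers_iff.1 hx
  refine ⟨k, Subtype.ext ?_⟩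
  have : (g ^ n) ^ p ^ k = (g ^ p ^ k) ^ n := by
    rw [← zpow_natCast, ← zpow_natCast, zpow_comm]
  simpa [hg] using this

theorem mem_of_pow_mem_of_coprime {G : Type*} [Group G] {H : Subgroup G} {g : G} {a b : ℕ}
    (hab : a.Coprime b) (ha : g ^ a ∈ H) (hb : g ^ b ∈ H) : g ∈ H := by
  have h := H.mul_mem (H.zpow_mem ha (a.gcdA b)) (H.zpow_mem hb (a.gcdB b))
  rwa [← zpow_natCast, ← zpow_natCast, ← zpow_mul, ← zpow_mul, ← zpow_add,
    ← Nat.gcd_eq_gcd_ab, hab, Nat.cast_one, zpow_one] at h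

section SylowOfCentral

variable {G : Type*} [Group G] {q : ℕ}

theorem sylow_eq_syl (hq : ∀ (g : G) (k : ℕ), g ^ q ^ k = 1 → g ∈ Subgroup.center G)
    (Q : Sylow q G) : (Q : Subgroup G) = syl q G := by
  have hle : ∀ R : Sylow q G, (R : Subgroup G) ≤ Subgroup.center G := fun R x hx => by
    obtain ⟨k, hk⟩ := R.isPGroup' ⟨x, hx⟩
    exact hq x k (congrArg Subtype.val hk)
  have hn : (Q : Subgroup G).Normal := ⟨fun x hx g => by
    rwa [Subgroup.mem_center_iff.1 (hle Q hx) g, mul_inv_cancel_right]⟩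
  exact le_antisymm (le_iSup (fun R : Sylow q G => (R : Subgroup G)) Q)
    (iSup_le fun R => IsPGroup.le_of_normal_sylow (P := Q) R.isPGroup')

theorem mem_syl_iff (hq : ∀ (g : G) (k : ℕ), g ^ q ^ k = 1 → g ∈ Subgroup.center G) {g : G} :
    g ∈ syl q G ↔ ∃ k, g ^ q ^ k = 1 := by
  let Q : Sylow q G := default
  have hQ := sylow_eq_syl hq Q
  constructor
  · intro hg
    rw [← hQ] at hg
    obtain ⟨k, hk⟩ := Q.isPGroup' ⟨g, hg⟩
    exact ⟨k, congrArg Subtype.val hk⟩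
  · rintro ⟨k, hk⟩
    have hn : (Q : Subgroup G).Normal := ⟨fun x hx g => by
      obtain ⟨k, hk⟩ := Q.isPGroup' ⟨x, hx⟩
      rwa [Subgroup.mem_center_iff.1 (hq x k (congrArg Subtype.val hk)) g,
        mul_inv_cancel_right]⟩
    rw [← hQ]
    exact mem_sylow_of_pow_eq_one hk

end SylowOfCentral

theorem exists_coprime_pow_eq_one_of_mem_iSup {G ι : Type*} [Group G] {H : ι → Subgroup G} {n : ℕ}
    (hc : ∀ i, H i ≤ Subgroup.center G)
    (hH : ∀ i, ∀ x ∈ H i, ∃ m : ℕ, m.Coprime n ∧ x ^ m = 1) {x : G} (hx : x ∈ ⨆ i, H i) :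
    ∃ m : ℕ, m.Coprime n ∧ x ^ m = 1 := by
  have key : x ∈ Subgroup.center G ∧ ∃ m : ℕ, m.Coprime n ∧ x ^ m = 1 := by
    induction hx using Subgroup.iSup_induction' with
    | hp i x hx => exact ⟨hc i hx, hH i x hx⟩
    | h1 => exact ⟨Subgroup.one_mem _, 1, by simp, by simp⟩
    | hmul x y _ _ hx hy =>
      obtain ⟨hx, m, hm, hxm⟩ := hx
      obtain ⟨hy, l, hl, hyl⟩ := hy
      refine ⟨Subgroup.mul_mem _ hx hy, m * l, hm.mul_left hl, ?_⟩
      have hxy : Commute x y := Subgroup.mem_center_iff.1 hy x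
      rw [hxy.mul_pow, pow_mul, hxm, mul_comm m l, pow_mul, hyl]
      simp
  exact key.2

section TorsionPart

variable {G : Type*} [Group G] {p : ℕ} [hp : Fact p.Prime]

theorem pow_prime_central
    (hc : ∀ (g : G) (m : ℕ), g ^ m = 1 → m.Coprime p → g ∈ Subgroup.center G) {q : ℕ} (hq : q.Prime) (hqp : q ≠ p) (g : G) (k : ℕ)
    (hg : g ^ q ^ k = 1) : g ∈ Subgroup.center G :=
  hc g _ hg (Nat.Coprime.pow_left k ((Nat.coprime_primes hq hp.out).2 hqp))

theorem syl_le_center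
    (hc : ∀ (g : G) (m : ℕ), g ^ m = 1 → m.Coprime p → g ∈ Subgroup.center G) {q : ℕ} (hq : q.Prime) (hqp : q ≠ p) : syl q G ≤ Subgroup.center G := by
  intro g hg
  obtain ⟨k, hk⟩ := (mem_syl_iff (pow_prime_central hc hq hqp)).1 hg
  exact pow_prime_central hc hq hqp g k hk

theorem primeToPart_le_center
    (hc : ∀ (g : G) (m : ℕ), g ^ m = 1 → m.Coprime p → g ∈ Subgroup.center G) : primeToPart p G ≤ Subgroup.center G :=
  iSup_le fun q => syl_le_center hc q.2.1 q.2.2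

theorem iSupIndep_syl
    (hc : ∀ (g : G) (m : ℕ), g ^ m = 1 → m.Coprime p → g ∈ Subgroup.center G) : iSupIndep (fun q : {q : ℕ // q.Prime ∧ q ≠ p} => syl (q : ℕ) G) := by
  intro q
  rw [Subgroup.disjoint_def]
  intro x hx hx'
  obtain ⟨k, hk⟩ := (mem_syl_iff (pow_prime_central hc q.2.1 q.2.2)).1 hx
  have : ∃ m : ℕ, m.Coprime (q : ℕ) ∧ x ^ m = 1 := by
    rw [iSup_subtype'] at hx'
    refine exists_coprime_pow_eq_one_of_mem_iSup
      (fun i => syl_le_center hc i.1.2.1 i.1.2.2) ?_ hx'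
    rintro ⟨r, hr⟩ y hy
    obtain ⟨l, hl⟩ := (mem_syl_iff (pow_prime_central hc r.2.1 r.2.2)).1 hy
    exact ⟨_, Nat.Coprime.pow_left l
      ((Nat.coprime_primes r.2.1 q.2.1).2 fun h => hr (Subtype.ext h)), hl⟩
  obtain ⟨m, hm, hxm⟩ := this
  have h := pow_gcd_eq_one.2 ⟨hxm, hk⟩
  rwa [Nat.Coprime.pow_right k hm, pow_one] at h

theorem mem_primeToPart_iff
    (hc : ∀ (g : G) (m : ℕ), g ^ m = 1 → m.Coprime p → g ∈ Subgroup.center G) {g : G} :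
    g ∈ primeToPart p G ↔ ∃ m : ℕ, m.Coprime p ∧ g ^ m = 1 := by
  constructor
  · intro hg
    refine exists_coprime_pow_eq_one_of_mem_iSup (fun q => syl_le_center hc q.2.1 q.2.2) ?_ hg
    intro q y hy
    obtain ⟨k, hk⟩ := (mem_syl_iff (pow_prime_central hc q.2.1 q.2.2)).1 hy
    exact ⟨_, Nat.Coprime.pow_left k ((Nat.coprime_primes q.2.1 hp.out).2 q.2.2), hk⟩
  · rintro ⟨m, hm, hgm⟩
    induction m using Nat.recOnPosPrimePosCoprime generalizing g with
    | zero =>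
      rw [Nat.coprime_zero_left] at hm
      exact absurd hm hp.out.one_lt.ne'
    | one =>
      rw [pow_one] at hgm
      exact hgm ▸ Subgroup.one_mem _
    | prime_pow q k hq hk =>
      have hqp : q ≠ p := by
        rintro rfl
        rw [Nat.coprime_pow_left_iff hk, Nat.coprime_self] at hm
        exact hq.one_lt.ne' hm
      exact le_iSup (fun q : {q : ℕ // q.Prime ∧ q ≠ p} => syl (q : ℕ) G) ⟨q, hq, hqp⟩
        ((mem_syl_iff (pow_prime_central hc hq hqp)).2 ⟨k, hgm⟩)
    | coprime a b _ _ hab iha ihb =>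
      refine mem_of_pow_mem_of_coprime hab ?_ ?_
      · exact ihb hm.coprime_mul_left (by rwa [← pow_mul])
      · exact iha hm.coprime_mul_right (by rwa [← pow_mul, mul_comm])

theorem disjoint_sylow_primeToPart {P : Sylow p G}
    (hc : ∀ (g : G) (m : ℕ), g ^ m = 1 → m.Coprime p → g ∈ Subgroup.center G) : Disjoint (P : Subgroup G) (primeToPart p G) := by
  rw [Subgroup.disjoint_def]
  intro x hx hx'
  obtain ⟨k, hk⟩ := P.isPGroup' ⟨x, hx⟩
  obtain ⟨m, hm, hxm⟩ := (mem_primeToPart_iff hc).1 hx'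
  have h := pow_gcd_eq_one.2 ⟨hxm, congrArg Subtype.val hk⟩
  rwa [Nat.Coprime.pow_right k hm, pow_one] at h

theorem mem_sylow_sup_primeToPart_iff {P : Sylow p G} [(P : Subgroup G).Normal]
    (hc : ∀ (g : G) (m : ℕ), g ^ m = 1 → m.Coprime p → g ∈ Subgroup.center G) {g : G} :
    g ∈ (P : Subgroup G) ⊔ primeToPart p G ↔ IsOfFinOrder g := by
  constructor
  · intro hg
    obtain ⟨x, hx, y, hy, rfl⟩ := Subgroup.mem_sup_of_normal_left.1 hg
    have hxy : Commute x y := Subgroup.mem_center_iff.1 (primeToPart_le_center hc hy) x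
    obtain ⟨k, hk⟩ := P.isPGroup' ⟨x, hx⟩
    obtain ⟨m, hm, hym⟩ := (mem_primeToPart_iff hc).1 hy
    refine hxy.isOfFinOrder_mul
      (isOfFinOrder_iff_pow_eq_one.2 ⟨p ^ k, pow_pos hp.out.pos k, congrArg Subtype.val hk⟩)
      (isOfFinOrder_iff_pow_eq_one.2 ⟨m, Nat.pos_of_ne_zero ?_, hym⟩)
    rintro rfl
    rw [Nat.coprime_zero_left] at hm
    exact hp.out.one_lt.ne' hm
  · intro hg
    obtain ⟨n, hn, hgn⟩ := isOfFinOrder_iff_pow_eq_one.1 hg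
    obtain ⟨k, m, hpm, rfl⟩ := Nat.exists_eq_pow_mul_and_not_dvd hn.ne' p hp.out.ne_one
    have hmp : m.Coprime p := ((Nat.Prime.coprime_iff_not_dvd hp.out).2 hpm).symm
    refine mem_of_pow_mem_of_coprime (Nat.Coprime.pow_right k hmp) ?_ ?_
    · exact Subgroup.mem_sup_left (mem_sylow_of_pow_eq_one (k := k) (by
        rwa [← pow_mul, mul_comm]))
    · exact Subgroup.mem_sup_right ((mem_primeToPart_iff hc).2 ⟨m, hmp, by rwa [← pow_mul]⟩)

theorem subgroupM_eq_top {P : Sylow p G} [(P : Subgroup G).Normal]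
    (hc : ∀ (g : G) (m : ℕ), g ^ m = 1 → m.Coprime p → g ∈ Subgroup.center G) : subgroupM p (P : Subgroup G) = ⊤ := by
  rw [eq_top_iff]
  intro x _
  by_cases hx : IsOfFinOrder x
  · induction x using QuotientGroup.induction_on with | _ g => ?_
    have hg : IsOfFinOrder g := by
      obtain ⟨n, hn, hgn⟩ := isOfFinOrder_iff_pow_eq_one.1 hx
      rw [← QuotientGroup.mk_pow, QuotientGroup.eq_one_iff] at hgn
      exact ((mem_sylow_sup_primeToPart_iff hc).1 (Subgroup.mem_sup_left hgn)).of_pow hn.ne'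
    obtain ⟨a, ha, d, hd, rfl⟩ :=
      Subgroup.mem_sup_of_normal_left.1 ((mem_sylow_sup_primeToPart_iff (P := P) hc).2 hg)
    refine Subgroup.subset_closure (Or.inl ⟨d, hd, ?_⟩)
    simpa [QuotientGroup.eq] using ha
  · exact Subgroup.subset_closure (Or.inr hx)

end TorsionPart

/-! ### Finite pure subgroups of abelian groups are direct factors -/

open CharacterModule in
/-- A character of `D` killed by `n` extends to a character of `M` killed by `n` whenever `D` is
pure in `M`: purity means that `D / nD` embeds into `M / nM`, and `ℚ/ℤ` is injective. -/
theorem exists_extend_character {D M : Type*} [AddCommGroup D] [AddCommGroup M] {j : D →+ M}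
    (hj : Function.Injective j) (hpure : ∀ (m : M) (k : ℕ), k ≠ 0 → k • m ∈ j.range → m ∈ j.range)
    {n : ℕ} (hn : n ≠ 0) (χ : D →+ AddCircle (1 : ℚ)) (hχ : ∀ d, n • χ d = 0) :
    ∃ ψ : M →+ AddCircle (1 : ℚ), (∀ d, ψ (j d) = χ d) ∧ ∀ m, n • ψ m = 0 := by
  let N : AddSubgroup M := (nsmulAddMonoidHom n : M →+ M).range
  let f : D →+ M ⧸ N := (QuotientAddGroup.mk' N).comp j
  have hker : f.ker ≤ χ.ker := by
    intro d hd
    obtain ⟨m, hm⟩ : j d ∈ N := (QuotientAddGroup.eq_zero_iff _).1 hd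
    have hm' : n • m = j d := hm
    obtain ⟨d', rfl⟩ := hpure m n hn ⟨d, hm'.symm⟩
    have : d = n • d' := hj (by rw [map_nsmul, hm'])
    rw [AddMonoidHom.mem_ker, this, map_nsmul, hχ]
  let χ' : CharacterModule (D ⧸ f.ker) := QuotientAddGroup.lift f.ker χ hker
  obtain ⟨ψ, hψ⟩ := dual_surjective_of_injective (QuotientAddGroup.kerLift f).toIntLinearMap
    (QuotientAddGroup.kerLift_injective f) χ'
  let ψ₀ : M ⧸ N →+ AddCircle (1 : ℚ) := ψ
  refine ⟨ψ₀.comp (QuotientAddGroup.mk' N), fun d => ?_, fun m => ?_⟩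
  · exact DFunLike.congr_fun hψ (QuotientAddGroup.mk d)
  · rw [← map_nsmul, AddMonoidHom.comp_apply]
    have : QuotientAddGroup.mk' N (n • m) = 0 := (QuotientAddGroup.eq_zero_iff _).2 ⟨m, rfl⟩
    rw [this, map_zero]

/-- `ZMod n` is the full `n`-torsion of `ℚ/ℤ`. -/
theorem exists_zmod_embedding (n : ℕ) (hn : n ≠ 0) :
    ∃ ι : ZMod n →+ AddCircle (1 : ℚ), Function.Injective ι ∧
      ∀ x, n • x = 0 → x ∈ ι.range := by
  have hn' : 0 < n := Nat.pos_of_ne_zero hn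
  have : Fact ((0 : ℚ) < 1) := ⟨one_pos⟩
  let a : AddCircle (1 : ℚ) := ((1 / n : ℚ) : AddCircle (1 : ℚ))
  have ha : addOrderOf a = n := AddCircle.addOrderOf_period_div hn'
  have ha0 : zmultiplesHom (AddCircle (1 : ℚ)) a n = 0 := by
    have := addOrderOf_nsmul_eq_zero a
    rw [ha] at this
    simpa using this
  refine ⟨ZMod.lift n ⟨zmultiplesHom _ a, ha0⟩, ?_, ?_⟩
  · rw [ZMod.lift_injective]
    intro m hm
    have hm' : m • a = 0 := hm
    rw [ZMod.intCast_zmod_eq_zero_iff_dvd]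
    rw [← ha]
    exact addOrderOf_dvd_iff_zsmul_eq_zero.2 hm'
  · intro x hx
    obtain ⟨m, -, hm⟩ := (AddCircle.nsmul_eq_zero_iff (p := (1 : ℚ)) hn').1 hx
    refine ⟨(m : ℤ), ?_⟩
    rw [ZMod.lift_coe]
    change (m : ℤ) • a = x
    rw [← hm, natCast_zsmul, ← AddCircle.coe_nsmul]
    congr 1
    simp [div_eq_mul_inv]

/-- A finite pure subgroup `D` of an abelian group `M` is a retract: each cyclic coordinate of `D`,
read as a character of `D`, extends to `M` without raising its order. -/
theorem exists_retraction {D M : Type*} [Group D] [Finite D] [Group M]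
    (hM : ∀ a b : M, a * b = b * a) {j : D →* M} (hj : Function.Injective j)
    (hpure : ∀ (m : M) (k : ℕ), k ≠ 0 → m ^ k ∈ j.range → m ∈ j.range) :
    ∃ r : M →* D, ∀ d, r (j d) = d := by
  let _ : CommGroup M := { ‹Group M› with mul_comm := hM }
  let _ : CommGroup D := { ‹Group D› with
    mul_comm := fun a b => hj (by rw [map_mul, map_mul, hM]) }
  obtain ⟨ι, _, n, hn, ⟨e⟩⟩ := CommGroup.equiv_prod_multiplicative_zmod_of_finite D
  have key : ∀ i, ∃ r : M →* Multiplicative (ZMod (n i)), ∀ d, r (j d) = e d i := by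
    intro i
    have hni : n i ≠ 0 := (zero_lt_one.trans (hn i)).ne'
    obtain ⟨ε, hε, hεr⟩ := exists_zmod_embedding (n i) hni
    let π : Additive D →+ ZMod (n i) := MonoidHom.toAdditiveLeft
      ((Pi.evalMonoidHom (fun i => Multiplicative (ZMod (n i))) i).comp e.toMonoidHom)
    obtain ⟨ψ, hψ, hψn⟩ := exists_extend_character (j := MonoidHom.toAdditive j) hj
      (fun m k hk hm => hpure m k hk hm) hni (ε.comp π) (fun d => by
        rw [← map_nsmul]; simp)
    let ρ : Additive M →+ ZMod (n i) := (AddMonoidHom.ofInjective hε).symm.toAddMonoidHom.comp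
      (ψ.codRestrict ε.range (fun m => hεr _ (hψn m)))
    refine ⟨AddMonoidHom.toMultiplicativeRight ρ, fun d => ?_⟩
    have : ρ (Additive.ofMul (j d)) = π (Additive.ofMul d) := by
      apply hε
      have h1 : ε (ρ (Additive.ofMul (j d))) = ψ (Additive.ofMul (j d)) :=
        congrArg Subtype.val ((AddMonoidHom.ofInjective hε).apply_symm_apply
          (ψ.codRestrict ε.range (fun m => hεr _ (hψn m)) (Additive.ofMul (j d))))
      exact h1.trans (hψ (Additive.ofMul d))
    exact this
  choose r hr using key
  refine ⟨e.symm.toMonoidHom.comp (MonoidHom.pi r), fun d => ?_⟩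
  have : MonoidHom.pi r (j d) = e d := funext fun i => hr i d
  change e.symm (MonoidHom.pi r (j d)) = d
  rw [this, e.symm_apply_apply]

/-- An extension of `A` by a finite pure subgroup `D` of an abelian group splits. -/
theorem nonempty_equiv_prod_of_finite {D M A : Type*} [Group D] [Finite D] [Group M] [Group A]
    (hM : ∀ a b : M, a * b = b * a) {j : D →* M} (hj : Function.Injective j)
    (hpure : ∀ (m : M) (k : ℕ), k ≠ 0 → m ^ k ∈ j.range → m ∈ j.range) {g : M →* A}
    (hg : Function.Surjective g) (hgj : g.ker = j.range) : Nonempty (M ≃* A × D) := by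
  obtain ⟨r, hr⟩ := exists_retraction hM hj hpure
  have hgj1 : ∀ d, g (j d) = 1 := fun d => by
    have : j d ∈ g.ker := hgj ▸ ⟨d, rfl⟩
    exact this
  refine ⟨MulEquiv.ofBijective (g.prod r) ⟨?_, ?_⟩⟩
  · rw [injective_iff_map_eq_one]
    intro m hm
    obtain ⟨d, rfl⟩ : m ∈ j.range := hgj ▸ (congrArg Prod.fst hm : g m = 1)
    have hd : r (j d) = 1 := congrArg Prod.snd hm
    rw [hr] at hd
    rw [hd, map_one]
  · rintro ⟨a, d⟩
    obtain ⟨m, rfl⟩ := hg a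
    refine ⟨m * j ((r m)⁻¹ * d), Prod.ext ?_ ?_⟩
    · change g _ = _
      rw [map_mul, hgj1, mul_one]
    · change r _ = _
      rw [map_mul, hr, mul_inv_cancel_left]

/-! ### Kernels of maps of group algebras -/

section Kernel

variable {F G H : Type*} [Field F] [Group G] [Group H]

theorem groupAlgebraMap_single (f : G →* H) (g : G) (r : F) :
    groupAlgebraMap F f (MonoidAlgebra.single g r) = MonoidAlgebra.single (f g) r := by
  simp [groupAlgebraMap]

theorem groupAlgebraMap_of (f : G →* H) (g : G) :
    groupAlgebraMap F f (MonoidAlgebra.of F G g) = MonoidAlgebra.of F H (f g) := by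
  simp [groupAlgebraMap]

theorem groupAlgebraMap_injective {f : G →* H} (hf : Function.Injective f) :
    Function.Injective (groupAlgebraMap F f) :=
  MonoidAlgebra.mapDomain_injective hf

theorem groupAlgebraMap_surjective {f : G →* H} (hf : Function.Surjective f) :
    Function.Surjective (groupAlgebraMap F f) := by
  intro y
  induction y using MonoidAlgebra.induction_linear with
  | zero => exact ⟨0, map_zero _⟩
  | add x y hx hy =>
    obtain ⟨a, rfl⟩ := hx
    obtain ⟨b, rfl⟩ := hy
    exact ⟨a + b, map_add _ _ _⟩
  | single h r =>
    obtain ⟨g, rfl⟩ := hf h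
    exact ⟨MonoidAlgebra.single g r, groupAlgebraMap_single f g r⟩

/-- An element of the kernel of `FG → FH` written out as a combination of products `g * (k - 1)`
with `k` in the kernel of `f`; the factor `g` is a chosen representative of its fibre. -/
theorem eq_sum_of_groupAlgebraMap_eq_zero (f : G →* H) {x : MonoidAlgebra F G}
    (hx : groupAlgebraMap F f x = 0) :
    x = x.coeff.sum fun g r => r • (MonoidAlgebra.of F G (Function.invFun f (f g)) *
      (MonoidAlgebra.of F G ((Function.invFun f (f g))⁻¹ * g) - 1)) := by
  have h0 : MonoidAlgebra.mapDomain (Function.invFun f) (groupAlgebraMap F f x) = 0 := by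
    rw [hx, MonoidAlgebra.mapDomain_zero]
  have h1 : ∀ y : MonoidAlgebra F G,
      MonoidAlgebra.mapDomain (Function.invFun f) (groupAlgebraMap F f y) =
        y.coeff.sum fun g r => MonoidAlgebra.single (Function.invFun f (f g)) r := by
    intro y
    induction y using MonoidAlgebra.induction_linear with
    | zero => simp
    | add a b ha hb =>
      rw [map_add, MonoidAlgebra.mapDomain_add, ha, hb, MonoidAlgebra.coeff_add,
        Finsupp.sum_add_index']
      · simp
      · intro g r s
        rw [← MonoidAlgebra.single_add]
    | single g r =>
      rw [groupAlgebraMap_single, MonoidAlgebra.mapDomain_single, MonoidAlgebra.coeff_single,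
        Finsupp.sum_single_index (by simp)]
  have h2 : ∀ (g : G) (r : F), r • (MonoidAlgebra.of F G (Function.invFun f (f g)) *
      (MonoidAlgebra.of F G ((Function.invFun f (f g))⁻¹ * g) - 1)) =
      MonoidAlgebra.single g r - MonoidAlgebra.single (Function.invFun f (f g)) r := by
    intro g r
    rw [mul_sub, ← map_mul, mul_inv_cancel_left, mul_one, smul_sub]
    simp [MonoidAlgebra.of_apply]
  simp only [h2]
  rw [Finsupp.sum_sub, ← h1, h0, sub_zero]
  exact (MonoidAlgebra.sum_coeff_single x).symm

theorem inv_invFun_mul_mem_ker (f : G →* H) (g : G) : (Function.invFun f (f g))⁻¹ * g ∈ f.ker := by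
  rw [MonoidHom.mem_ker, map_mul, map_inv, Function.invFun_eq (f := f) ⟨g, rfl⟩, inv_mul_cancel]

theorem mem_subgroupIdeal_ker_iff (f : G →* H) {x : MonoidAlgebra F G} :
    x ∈ subgroupIdeal F f.ker ↔ groupAlgebraMap F f x = 0 := by
  constructor
  · intro hx
    have hle : subgroupIdeal F f.ker ≤ TwoSidedIdeal.ker (groupAlgebraMap F f) := by
      refine TwoSidedIdeal.span_le.2 ?_
      rintro _ ⟨k, hk, rfl⟩
      refine (TwoSidedIdeal.mem_ker _).2 ?_
      rw [map_sub, groupAlgebraMap_of, MonoidHom.mem_ker.1 hk, map_one, map_one, sub_self]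
    exact (TwoSidedIdeal.mem_ker _).1 (hle hx)
  · intro hx
    rw [eq_sum_of_groupAlgebraMap_eq_zero f hx]
    refine sum_mem fun g _ => ?_
    change x.coeff g • (_ * _) ∈ _
    rw [← smul_mul_assoc]
    exact TwoSidedIdeal.mul_mem_left _ _ _
      (TwoSidedIdeal.subset_span ⟨_, inv_invFun_mul_mem_ker f g, rfl⟩)

theorem normalizedUnits_coe_injective :
    Function.Injective fun u : normalizedUnits F G => ((u : (MonoidAlgebra F G)ˣ) :
      MonoidAlgebra F G) :=
  Units.val_injective.comp Subtype.val_injective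

theorem coe_normalizedUnitsMap (f : G →* H) (u : normalizedUnits F G) :
    ((normalizedUnitsMap F f u : (MonoidAlgebra F H)ˣ) : MonoidAlgebra F H) =
      groupAlgebraMap F f ((u : (MonoidAlgebra F G)ˣ) : MonoidAlgebra F G) := rfl

theorem augmentation_normalizedUnits (u : normalizedUnits F G) :
    augmentationHom F G ((u : (MonoidAlgebra F G)ˣ) : MonoidAlgebra F G) = 1 :=
  congrArg Units.val (MonoidHom.mem_ker.1 u.2)

theorem exists_normalizedUnits_of_isUnit {x : MonoidAlgebra F G} (hx : IsUnit x)
    (h : augmentationHom F G x = 1) :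
    ∃ u : normalizedUnits F G, ((u : (MonoidAlgebra F G)ˣ) : MonoidAlgebra F G) = x :=
  ⟨⟨hx.unit, MonoidHom.mem_ker.2 (Units.ext h)⟩, rfl⟩

theorem normalizedUnitsMap_injective {f : G →* H} (hf : Function.Injective f) :
    Function.Injective (normalizedUnitsMap F f) := fun _ _ huv =>
  normalizedUnits_coe_injective (groupAlgebraMap_injective hf
    (congrArg (fun w : normalizedUnits F H => ((w : (MonoidAlgebra F H)ˣ) : MonoidAlgebra F H))
      huv))

theorem ker_normalizedUnitsMap (f : G →* H) :
    (normalizedUnitsMap F f).ker = onePlus (subgroupIdeal F f.ker) := by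
  ext u
  have h : u ∈ onePlus (subgroupIdeal F f.ker) ↔
      ((u : (MonoidAlgebra F G)ˣ) : MonoidAlgebra F G) - 1 ∈ subgroupIdeal F f.ker := Iff.rfl
  rw [h, mem_subgroupIdeal_ker_iff, map_sub, map_one, sub_eq_zero, ← coe_normalizedUnitsMap,
    MonoidHom.mem_ker, ← normalizedUnits_coe_injective.eq_iff]
  rfl

theorem normalizedUnits_mul_comm (hH : ∀ a b : H, a * b = b * a) (u v : normalizedUnits F H) :
    u * v = v * u := by
  let _ : CommGroup H := { ‹Group H› with mul_comm := hH }
  exact normalizedUnits_coe_injective (mul_comm (_ : MonoidAlgebra F H) _)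

theorem commutator_normalizedUnits_le :
    commutator (normalizedUnits F G) ≤ onePlus (subgroupIdeal F (commutator G)) := by
  have h := ker_normalizedUnitsMap (F := F) (QuotientGroup.mk' (commutator G))
  rw [QuotientGroup.ker_mk'] at h
  rw [← h, commutator_def, Subgroup.commutator_le]
  intro u _ v _
  have hcomm : ∀ a b : G ⧸ commutator G, a * b = b * a :=
    @mul_comm (Abelianization G) _
  rw [MonoidHom.mem_ker, map_commutatorElement, commutatorElement_eq_one_iff_mul_comm]
  exact normalizedUnits_mul_comm hcomm _ _

/-- The embedding of `G` into `V(FG)`. -/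
noncomputable def groupToNormalizedUnits (F G : Type*) [Field F] [Group G] : G →* normalizedUnits F G :=
  ((Units.map (MonoidAlgebra.of F G)).comp toUnits.toMonoidHom).codRestrict _ fun g =>
    MonoidHom.mem_ker.2 (Units.ext (by simp [augmentationHom]))

theorem groupToNormalizedUnits_injective :
    Function.Injective (groupToNormalizedUnits F G) := fun _ _ hgh =>
  MonoidAlgebra.of_injective (congrArg
    (fun w : normalizedUnits F G => ((w : (MonoidAlgebra F G)ˣ) : MonoidAlgebra F G)) hgh)

end Kernel

/-! ### Nilpotency of augmentation ideals -/

theorem Submodule.mul_pow_le_mul_pow {R A : Type*} [CommSemiring R] [Semiring A] [Algebra R A]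
    {B N : Submodule R A} (h1 : 1 ≤ B) (hB : B * B ≤ B) (hN : N * B ≤ B * N) (m : ℕ) :
    (B * N) ^ m ≤ B * N ^ m := by
  have hNm : ∀ m : ℕ, N ^ m * B ≤ B * N ^ m := by
    intro m
    induction m with
    | zero => simp
    | succ m ih =>
      calc N ^ (m + 1) * B = N ^ m * (N * B) := by rw [pow_succ, mul_assoc]
        _ ≤ N ^ m * (B * N) := by gcongr
        _ = N ^ m * B * N := by rw [mul_assoc]
        _ ≤ B * N ^ m * N := by gcongr
        _ = B * N ^ (m + 1) := by rw [pow_succ, mul_assoc]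
  induction m with
  | zero => simpa using h1
  | succ m ih =>
    calc (B * N) ^ (m + 1) = (B * N) ^ m * (B * N) := pow_succ _ _
      _ ≤ B * N ^ m * (B * N) := by gcongr
      _ = B * (N ^ m * B) * N := by simp only [mul_assoc]
      _ ≤ B * (B * N ^ m) * N := mul_le_mul' (mul_le_mul' le_rfl (hNm m)) le_rfl
      _ = B * B * (N ^ m * N) := by simp only [mul_assoc]
      _ ≤ B * (N ^ m * N) := by gcongr
      _ = B * N ^ (m + 1) := by rw [pow_succ]

section Augmentation

variable (F : Type*) {G H : Type*} [Field F] [Group G] [Group H]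

/-- The `F`-span of the elements `k - 1`, `k ∈ K`: the augmentation ideal of `FK`, viewed inside
`FG`. -/
noncomputable def augSpan (K : Subgroup G) : Submodule F (MonoidAlgebra F G) :=
  Submodule.span F ((fun k => MonoidAlgebra.of F G k - 1) '' (K : Set G))

theorem map_augSpan (f : G →* H) (K : Subgroup G) :
    (augSpan F K).map (groupAlgebraMap F f).toLinearMap = augSpan F (K.map f) := by
  rw [augSpan, augSpan, Submodule.map_span, Subgroup.coe_map, Set.image_image, Set.image_image]
  congr 1
  refine Set.image_congr fun k _ => ?_
  simp [groupAlgebraMap_of, -MonoidAlgebra.of_apply]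

variable {F} in
theorem mem_top_mul_augSpan_ker (f : G →* H) {x : MonoidAlgebra F G}
    (hx : groupAlgebraMap F f x = 0) : x ∈ ⊤ * augSpan F f.ker := by
  rw [eq_sum_of_groupAlgebraMap_eq_zero f hx]
  refine sum_mem fun g _ => Submodule.smul_mem _ _ (Submodule.mul_mem_mul trivial ?_)
  exact Submodule.subset_span ⟨_, inv_invFun_mul_mem_ker f g, rfl⟩

theorem augSpan_pow_map {K : Subgroup G} {n : ℕ} (f : G →* H) (h : augSpan F K ^ n = ⊥) :
    augSpan F (K.map f) ^ n = ⊥ := by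
  rw [← map_augSpan, ← Submodule.map_pow, h, Submodule.map_bot]

variable (p : ℕ) [Fact p.Prime] [CharP F p]

theorem exists_augSpan_pow_eq_bot_of_comm {Z : Type*} [Group Z] [Finite Z]
    (hcomm : ∀ a b : Z, a * b = b * a) (hZ : IsPGroup p Z) :
    ∃ n, augSpan F (⊤ : Subgroup Z) ^ n = ⊥ := by
  let _ : CommGroup Z := { ‹Group Z› with mul_comm := hcomm }
  have : IsNoetherianRing (MonoidAlgebra F Z) := IsNoetherianRing.of_finite F _
  have : CharP (MonoidAlgebra F Z) p :=
    charP_of_injective_algebraMap (algebraMap F (MonoidAlgebra F Z)).injective p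
  obtain ⟨n, hn⟩ := IsNoetherianRing.isNilpotent_nilradical (MonoidAlgebra F Z)
  have hle : augSpan F (⊤ : Subgroup Z) ≤ (nilradical (MonoidAlgebra F Z)).restrictScalars F := by
    refine Submodule.span_le.2 ?_
    rintro _ ⟨z, -, rfl⟩
    obtain ⟨k, hk⟩ := hZ z
    refine mem_nilradical.2 ⟨p ^ k, ?_⟩
    rw [sub_pow_char_pow, one_pow, ← map_pow, hk, map_one, sub_self]
  have hpow : ∀ m : ℕ, augSpan F (⊤ : Subgroup Z) ^ m ≤
      (nilradical (MonoidAlgebra F Z) ^ m).restrictScalars F := by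
    intro m
    induction m with
    | zero => intro x _; simp
    | succ m ih =>
      rw [pow_succ, pow_succ, Submodule.mul_le]
      exact fun a ha b hb => Ideal.mul_mem_mul (ih ha) (hle hb)
  refine ⟨n, le_bot_iff.1 ((hpow n).trans ?_)⟩
  rw [hn]
  exact fun x hx => hx

/-- The augmentation ideal of a finite `p`-group in characteristic `p` is nilpotent. -/
theorem exists_augSpan_pow_eq_bot {K : Type*} [Group K] [Finite K]
    (hK : IsPGroup p K) : ∃ n, augSpan F (⊤ : Subgroup K) ^ n = ⊥ := by
  have := hK.isNilpotent
  revert hK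
  have hfin : Finite K := inferInstance
  revert hfin
  refine Group.nilpotent_center_quotient_ind (P := fun K _ _ => Finite K → IsPGroup p K →
    ∃ n, augSpan F (⊤ : Subgroup K) ^ n = ⊥) K ?_ ?_
  · intro K _ _ _ _
    refine ⟨1, ?_⟩
    rw [pow_one, augSpan, Submodule.span_eq_bot]
    rintro _ ⟨k, -, rfl⟩
    simp only [Subsingleton.elim k 1, map_one, sub_self]
  · intro K _ _ ih hfin hK
    obtain ⟨n, hn⟩ := ih inferInstance (hK.to_quotient _)
    obtain ⟨m, hm⟩ := exists_augSpan_pow_eq_bot_of_comm F p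
      (fun a b => Subtype.ext (Subgroup.mem_center_iff.1 b.2 a)) (hK.to_subgroup (Subgroup.center K))
    have hZ : augSpan F (Subgroup.center K) ^ m = ⊥ := by
      have := augSpan_pow_map F (Subgroup.center K).subtype hm
      rwa [← MonoidHom.range_eq_map, Subgroup.range_subtype] at this
    have h1 : augSpan F (⊤ : Subgroup K) ^ n ≤ ⊤ * augSpan F (Subgroup.center K) := by
      intro x hx
      have h2 : groupAlgebraMap F (QuotientGroup.mk' (Subgroup.center K)) x ∈
          (augSpan F (⊤ : Subgroup K) ^ n).map
            (groupAlgebraMap F (QuotientGroup.mk' (Subgroup.center K))).toLinearMap := ⟨x, hx, rfl⟩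
      rw [Submodule.map_pow, map_augSpan,
        Subgroup.map_top_of_surjective _ (QuotientGroup.mk'_surjective _), hn,
        Submodule.mem_bot] at h2
      have := mem_top_mul_augSpan_ker _ h2
      rwa [QuotientGroup.ker_mk'] at this
    have h3 : augSpan F (Subgroup.center K) * ⊤ ≤ ⊤ * augSpan F (Subgroup.center K) := by
      rw [Submodule.mul_le]
      intro a ha b _
      suffices h : Commute a b by
        rw [h.eq]
        exact Submodule.mul_mem_mul trivial ha
      induction ha using Submodule.span_induction with
      | mem a ha =>
        obtain ⟨z, hz, rfl⟩ := ha
        refine Commute.sub_left ?_ (Commute.one_left b)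
        exact MonoidAlgebra.of_commute (fun g => (Subgroup.mem_center_iff.1 hz g).symm) b
      | zero => exact Commute.zero_left b
      | add x y _ _ hx hy => exact hx.add_left hy
      | smul r x _ hx => exact hx.smul_left r
    refine ⟨n * m, le_bot_iff.1 ?_⟩
    rw [pow_mul]
    calc (augSpan F (⊤ : Subgroup K) ^ n) ^ m ≤ (⊤ * augSpan F (Subgroup.center K)) ^ m := by
          gcongr
      _ ≤ ⊤ * augSpan F (Subgroup.center K) ^ m :=
          Submodule.mul_pow_le_mul_pow le_top le_top h3 m
      _ = ⊥ := by rw [hZ, Submodule.mul_bot]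

variable {p} in
/-- The ideal `𝔍(P)` is nil: by the Engel condition, an element of it lies in `FH * Δ(K)` for a
finite `p`-subgroup `K` normalized by `H`, and this product is nilpotent because `Δ(K)` is. -/
theorem isNilpotent_of_mem_subgroupIdeal (hE : IsEngelGroup G) {P : Subgroup G} [P.Normal]
    (hP : IsPGroup p P) (hGP : commutator G ≤ P)
    (hfin : ∀ S : Set G, S.Finite → S ⊆ P → Finite (Subgroup.closure S))
    {x : MonoidAlgebra F G} (hx : x ∈ subgroupIdeal F P) : IsNilpotent x := by
  classical
  let f := QuotientGroup.mk' P
  have hf : f.ker = P := QuotientGroup.ker_mk' P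
  rw [← hf, mem_subgroupIdeal_ker_iff] at hx
  let s : G → G := fun g => Function.invFun f (f g)
  let C : Set G := (fun g => (s g)⁻¹ * g) '' (x.coeff.support : Set G)
  obtain ⟨K, hK, hCK, hKP, hTK⟩ := exists_finite_le_normalized hE hGP hfin
    (x.coeff.support.image s) (C := C) (x.coeff.support.finite_toSet.image _) (by
      rintro _ ⟨g, -, rfl⟩
      have := inv_invFun_mul_mem_ker f g
      rwa [hf] at this)
  let N := augSpan F K
  let H : Subgroup G := Subgroup.normalizer (K : Set G)
  let B : Submodule F (MonoidAlgebra F G) :=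
    Submodule.span F ((fun h => MonoidAlgebra.of F G h) '' (H : Set G))
  have h1 : 1 ≤ B := by
    rw [Submodule.one_le]
    exact Submodule.subset_span ⟨1, H.one_mem, map_one _⟩
  have hB : B * B ≤ B := by
    rw [Submodule.span_mul_span, Submodule.span_le]
    rintro _ ⟨_, ⟨a, ha, rfl⟩, _, ⟨b, hb, rfl⟩, rfl⟩
    exact Submodule.subset_span ⟨a * b, H.mul_mem ha hb, map_mul _ _ _⟩
  have hN : N * B ≤ B * N := by
    change Submodule.span F _ * Submodule.span F _ ≤ _
    rw [Submodule.span_mul_span, Submodule.span_le]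
    rintro _ ⟨_, ⟨k, hk, rfl⟩, _, ⟨h, hh, rfl⟩, rfl⟩
    have hk' : h⁻¹ * k * h ∈ K := (Subgroup.mem_normalizer_iff''.1 hh k).1 hk
    have e : (MonoidAlgebra.of F G k - 1) * MonoidAlgebra.of F G h =
        MonoidAlgebra.of F G h * (MonoidAlgebra.of F G (h⁻¹ * k * h) - 1) := by
      rw [sub_mul, mul_sub, ← map_mul, ← map_mul, one_mul, mul_one]
      congr 2
      group
    change (MonoidAlgebra.of F G k - 1) * MonoidAlgebra.of F G h ∈ B * N
    rw [e]
    exact Submodule.mul_mem_mul (Submodule.subset_span ⟨h, hh, rfl⟩)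
      (Submodule.subset_span ⟨_, hk', rfl⟩)
  obtain ⟨n, hn⟩ := exists_augSpan_pow_eq_bot F p (hP.to_le hKP)
  have hNn : N ^ n = ⊥ := by
    have := augSpan_pow_map F K.subtype hn
    rwa [← MonoidHom.range_eq_map, Subgroup.range_subtype] at this
  have hxBN : x ∈ B * N := by
    rw [eq_sum_of_groupAlgebraMap_eq_zero f hx]
    refine sum_mem fun g hg => Submodule.smul_mem _ _ (Submodule.mul_mem_mul ?_ ?_)
    · exact Submodule.subset_span ⟨s g, hTK _ (Finset.mem_image_of_mem s hg), rfl⟩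
    · exact Submodule.subset_span ⟨_, hCK ⟨g, hg, rfl⟩, rfl⟩
  refine ⟨n, ?_⟩
  have := Submodule.mul_pow_le_mul_pow h1 hB hN n (Submodule.pow_mem_pow _ hxBN n)
  rwa [hNn, Submodule.mul_bot, Submodule.mem_bot] at this

end Augmentation

/-! ### The subgroup `1 + 𝔍(P)` of the normalized units -/

section OnePlus

variable {F G H : Type*} [Field F] [Group G] [Group H]

theorem exists_normalizedUnits_eq_one_add (f : G →* H)
    (hnil : ∀ x ∈ subgroupIdeal F f.ker, IsNilpotent x) {x : MonoidAlgebra F G}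
    (hx : x ∈ subgroupIdeal F f.ker) :
    ∃ u : normalizedUnits F G, ((u : (MonoidAlgebra F G)ˣ) : MonoidAlgebra F G) = 1 + x := by
  refine exists_normalizedUnits_of_isUnit (hnil x hx).isUnit_one_add ?_
  rw [map_add, map_one, ← augmentationHom_groupAlgebraMap F f,
    (mem_subgroupIdeal_ker_iff f).1 hx, map_zero, add_zero]

theorem isPGroup_onePlus {p : ℕ} [Fact p.Prime] [CharP F p] {I : TwoSidedIdeal (MonoidAlgebra F G)}
    (hnil : ∀ x ∈ I, IsNilpotent x) : IsPGroup p (onePlus I) := by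
  rintro ⟨u, hu⟩
  have hu' : ((u : (MonoidAlgebra F G)ˣ) : MonoidAlgebra F G) - 1 ∈ I := hu
  have : CharP (MonoidAlgebra F G) p :=
    charP_of_injective_algebraMap (algebraMap F (MonoidAlgebra F G)).injective p
  obtain ⟨n, hn⟩ := hnil _ hu'
  refine ⟨n, Subtype.ext (normalizedUnits_coe_injective ?_)⟩
  have h := sub_pow_char_pow_of_commute (p := p) (n := n)
    (Commute.one_right ((u : (MonoidAlgebra F G)ˣ) : MonoidAlgebra F G))
  rw [pow_eq_zero_of_le (Nat.lt_pow_self (Fact.out : p.Prime).one_lt).le hn, one_pow, eq_comm,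
    sub_eq_zero] at h
  simpa using h

theorem normalizedUnitsMap_surjective {f : G →* H} (hf : Function.Surjective f)
    (hnil : ∀ x ∈ subgroupIdeal F f.ker, IsNilpotent x) :
    Function.Surjective (normalizedUnitsMap F f) := by
  intro v
  obtain ⟨a, ha⟩ := groupAlgebraMap_surjective (F := F) hf
    ((v : (MonoidAlgebra F H)ˣ) : MonoidAlgebra F H)
  obtain ⟨b, hb⟩ := groupAlgebraMap_surjective (F := F) hf
    (((v : (MonoidAlgebra F H)ˣ)⁻¹ : (MonoidAlgebra F H)ˣ) : MonoidAlgebra F H)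
  have hunit : ∀ c, groupAlgebraMap F f c = 1 → IsUnit c := by
    intro c hc
    have := (hnil (c - 1) ((mem_subgroupIdeal_ker_iff f).2 (by
      rw [map_sub, hc, map_one, sub_self]))).isUnit_one_add
    rwa [add_sub_cancel] at this
  obtain ⟨c, hc⟩ := (hunit (a * b) (by rw [map_mul, ha, hb, Units.mul_inv])).exists_right_inv
  obtain ⟨d, hd⟩ := (hunit (b * a) (by rw [map_mul, ha, hb, Units.inv_mul])).exists_left_inv
  have hau : IsUnit a := by
    rw [mul_assoc] at hc
    rw [← mul_assoc] at hd
    exact ⟨⟨a, b * c, hc, (left_inv_eq_right_inv hd hc) ▸ hd⟩, rfl⟩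
  obtain ⟨u, hu⟩ := exists_normalizedUnits_of_isUnit hau (by
    rw [← augmentationHom_groupAlgebraMap F f, ha, augmentation_normalizedUnits])
  exact ⟨u, normalizedUnits_coe_injective (by
    change groupAlgebraMap F f ((u : (MonoidAlgebra F G)ˣ) : MonoidAlgebra F G) = _
    rw [hu, ha])⟩

/-- Reduction modulo a subgroup whose ideal is nil identifies `V(FG) / (1 + 𝔍(ker f))` with
`V(FH)`. -/
theorem nonempty_quotient_onePlus_equiv {f : G →* H} (hf : Function.Surjective f)
    (hnil : ∀ x ∈ subgroupIdeal F f.ker, IsNilpotent x) {P : Subgroup G} (hP : f.ker = P) :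
    Nonempty ((normalizedUnits F G ⧸ onePlus (subgroupIdeal F P)) ≃* normalizedUnits F H) := by
  subst hP
  exact ⟨(QuotientGroup.quotientMulEquivOfEq (ker_normalizedUnitsMap f).symm).trans
    (QuotientGroup.quotientKerEquivOfSurjective _ (normalizedUnitsMap_surjective hf hnil))⟩

end OnePlus

/-! ### Reducedness of commutative group algebras -/

/-- In characteristic `p`, the group algebra of an abelian group without `p`-torsion is reduced:
`(∑ a_m m) ^ p = ∑ a_m ^ p m ^ p`, and the elements `m ^ p` are distinct. -/
theorem isReduced_monoidAlgebra {F M : Type*} [Field F] [CommGroup M] (p : ℕ) [Fact p.Prime]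
    [CharP F p] (hM : ∀ m : M, m ^ p = 1 → m = 1) : IsReduced (MonoidAlgebra F M) := by
  have hp : p ≠ 0 := (Fact.out : p.Prime).ne_zero
  have : CharP (MonoidAlgebra F M) p :=
    charP_of_injective_algebraMap (algebraMap F (MonoidAlgebra F M)).injective p
  have hpow : ∀ x : MonoidAlgebra F M, x ^ p = MonoidAlgebra.mapDomain (fun m => m ^ p)
      (MonoidAlgebra.map (frobenius F p : F →+ F) x) := by
    intro x
    induction x using MonoidAlgebra.induction_linear with
    | zero => simp [hp]
    | add x y hx hy =>
      rw [add_pow_char, hx, hy, MonoidAlgebra.map_add, MonoidAlgebra.mapDomain_add]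
    | single m r =>
      rw [MonoidAlgebra.single_pow, MonoidAlgebra.map_single, MonoidAlgebra.mapDomain_single]
      rfl
  have hinj : Function.Injective fun m : M => m ^ p := by
    intro a b hab
    rw [← div_eq_one]
    exact hM _ (by rw [div_pow, div_eq_one]; exact hab)
  refine (isReduced_iff_pow_one_lt p (Fact.out : p.Prime).one_lt).2 fun x hx => ?_
  rw [hpow] at hx
  exact MonoidAlgebra.map_injective _ (frobenius F p).injective
    (MonoidAlgebra.mapDomain_injective hinj (by rw [hx, MonoidAlgebra.map_zero,
      MonoidAlgebra.mapDomain_zero]))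

/-- The normalized units of the group algebra of an abelian group without `p`-torsion have no
`p`-torsion. -/
theorem eq_one_of_pow_prime_pow_eq_one {F M : Type*} [Field F] [Group M]
    (hM : ∀ a b : M, a * b = b * a) {p : ℕ} [Fact p.Prime] [CharP F p]
    (hp : ∀ m : M, m ^ p = 1 → m = 1) {u : normalizedUnits F M} {k : ℕ} (hu : u ^ p ^ k = 1) :
    u = 1 := by
  let _ : CommGroup M := { ‹Group M› with mul_comm := hM }
  have := isReduced_monoidAlgebra (F := F) p hp
  have : CharP (MonoidAlgebra F M) p :=
    charP_of_injective_algebraMap (algebraMap F (MonoidAlgebra F M)).injective p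
  have hu' : ((u : (MonoidAlgebra F M)ˣ) : MonoidAlgebra F M) ^ p ^ k = 1 :=
    congrArg (fun w : normalizedUnits F M => ((w : (MonoidAlgebra F M)ˣ) : MonoidAlgebra F M)) hu
  refine normalizedUnits_coe_injective (sub_eq_zero.1 (IsNilpotent.eq_zero ⟨p ^ k, ?_⟩))
  change (((u : (MonoidAlgebra F M)ˣ) : MonoidAlgebra F M) - 1) ^ p ^ k = 0
  rw [sub_pow_char_pow, hu', one_pow, sub_self]

/-! ### Units of group algebras of torsion-free abelian groups -/

theorem IsTorsionFreeGroup.twoUniqueProds {A : Type*} [CommGroup A] (hA : IsTorsionFreeGroup A) :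
    TwoUniqueProds A := by
  classical
  refine ⟨fun {S T} hST => ?_⟩
  let H : Subgroup A := Subgroup.closure (S ∪ T : Finset A)
  have hS : ∀ x ∈ S, x ∈ H := fun x hx =>
    Subgroup.subset_closure (Finset.mem_coe.2 (Finset.mem_union_left _ hx))
  have hT : ∀ x ∈ T, x ∈ H := fun x hx =>
    Subgroup.subset_closure (Finset.mem_coe.2 (Finset.mem_union_right _ hx))
  have : Group.FG H := (Group.fg_iff_subgroup_fg H).2 ⟨S ∪ T, rfl⟩
  have : IsMulTorsionFree H := IsMulTorsionFree.of_not_isOfFinOrder fun x hx hfin =>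
    hx (Subtype.ext (hA x (Submonoid.isOfFinOrder_coe.2 hfin)))
  have hcard : ∀ U : Finset A, (∀ x ∈ U, x ∈ H) → (U.subtype (· ∈ H)).card = U.card := by
    intro U hU
    rw [Finset.card_subtype, Finset.filter_true_of_mem hU]
  obtain ⟨a, ha, b, hb, hab, hua, hub⟩ := TwoUniqueProds.uniqueMul_of_one_lt_card
    (A := S.subtype (· ∈ H)) (B := T.subtype (· ∈ H)) (by rwa [hcard S hS, hcard T hT])
  have hu : ∀ c : H × H, UniqueMul (S.subtype (· ∈ H)) (T.subtype (· ∈ H)) c.1 c.2 →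
      UniqueMul S T (c.1 : A) c.2 := by
    intro c hc x y hx hy hxy
    have := hc (a := ⟨x, hS x hx⟩) (b := ⟨y, hT y hy⟩) (by simpa using hx) (by simpa using hy)
      (Subtype.ext hxy)
    exact ⟨congrArg Subtype.val this.1, congrArg Subtype.val this.2⟩
  refine ⟨(a.1, a.2), by simpa using ha, (b.1, b.2), by simpa using hb, ?_, hu a hua, hu b hub⟩
  intro h
  rw [Prod.mk.injEq] at h
  exact hab (Prod.ext (Subtype.ext h.1) (Subtype.ext h.2))

/-- The group algebra of a torsion-free abelian group over a domain has only trivial units. -/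
theorem exists_eq_single_of_mul_eq_one {R A : Type*} [CommRing R] [IsDomain R] [CommGroup A]
    (hA : IsTorsionFreeGroup A) {u v : MonoidAlgebra R A} (huv : u * v = 1) :
    ∃ a c, u = MonoidAlgebra.single a c := by
  have := hA.twoUniqueProds
  have hu : u ≠ 0 := by rintro rfl; simp at huv
  have hv : v ≠ 0 := by rintro rfl; simp at huv
  have hun : u.coeff.support.Nonempty := by simpa [Finset.nonempty_iff_ne_empty] using hu
  have hvn : v.coeff.support.Nonempty := by simpa [Finset.nonempty_iff_ne_empty] using hv
  have hcard : ¬ 1 < u.coeff.support.card * v.coeff.support.card := by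
    intro h
    obtain ⟨x, hx, y, hy, hxy, hux, huy⟩ := TwoUniqueProds.uniqueMul_of_one_lt_card h
    rw [Finset.mem_product] at hx hy
    -- Both uniquely represented products occur in `u * v = 1`, hence both are equal to `1`.
    have key : ∀ z : A × A, z.1 ∈ u.coeff.support → z.2 ∈ v.coeff.support →
        UniqueMul u.coeff.support v.coeff.support z.1 z.2 → z.1 * z.2 = 1 := by
      intro z hz1 hz2 hz
      have h := MonoidAlgebra.coeff_mul_mul_of_uniqueMul hz
      by_contra hne
      rw [huv, MonoidAlgebra.one_def, MonoidAlgebra.coeff_single,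
        Finsupp.single_eq_of_ne hne] at h
      exact mul_ne_zero (Finsupp.mem_support_iff.1 hz1) (Finsupp.mem_support_iff.1 hz2) h.symm
    have h1 := hux hy.1 hy.2 ((key y hy.1 hy.2 huy).trans (key x hx.1 hx.2 hux).symm)
    exact hxy (Prod.ext h1.1.symm h1.2.symm)
  have hle : u.coeff.support.card ≤ 1 := by
    by_contra h
    exact hcard (lt_of_lt_of_le (not_le.1 h) (Nat.le_mul_of_pos_right _ hvn.card_pos))
  obtain ⟨a, ha⟩ := Finset.card_eq_one.1 (le_antisymm hle hun.card_pos)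
  obtain ⟨c, hc⟩ := Finsupp.support_subset_singleton'.1 ha.le
  exact ⟨a, c, MonoidAlgebra.coeff_injective hc⟩

section Degree

variable {K A : Type*} [Field K] [CommGroup A] (hA : IsTorsionFreeGroup A)

/-- The degree `a` of a unit `c a` of `KA`, for a field `K` and a torsion-free abelian group
`A`. -/
noncomputable def unitDegree (hA : IsTorsionFreeGroup A) (u : (MonoidAlgebra K A)ˣ) : A :=
  (exists_eq_single_of_mul_eq_one hA u.mul_inv).choose

theorem eq_single_unitDegree (u : (MonoidAlgebra K A)ˣ) :
    ∃ c, (u : MonoidAlgebra K A) = MonoidAlgebra.single (unitDegree hA u) c :=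
  (exists_eq_single_of_mul_eq_one hA u.mul_inv).choose_spec

theorem unitDegree_eq {u : (MonoidAlgebra K A)ˣ} {a : A} {c : K}
    (h : (u : MonoidAlgebra K A) = MonoidAlgebra.single a c) : unitDegree hA u = a := by
  obtain ⟨d, hd⟩ := eq_single_unitDegree hA u
  rw [hd] at h
  rcases MonoidAlgebra.single_inj.1 h with h | h
  · exact h.1
  · rw [h.1, MonoidAlgebra.single_zero] at hd
    exact absurd hd u.ne_zero

/-- The degree homomorphism from the units of `KA` to `A`. -/
noncomputable def unitDegreeHom : (MonoidAlgebra K A)ˣ →* A :=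
  MonoidHom.mk' (unitDegree hA) fun u v => by
    obtain ⟨c, hc⟩ := eq_single_unitDegree hA u
    obtain ⟨d, hd⟩ := eq_single_unitDegree hA v
    exact unitDegree_eq hA (c := c * d) (by
      rw [Units.val_mul, hc, hd, MonoidAlgebra.single_mul_single])

end Degree

/-! ### Purity of the normalized units of the torsion part -/

section Pure

variable {F D M : Type*} [Field F] [CommGroup M] [Group D]

/-- The homomorphism `FM → (FM)[M/N]`, `m ↦ m [mN]`, encoding the grading of `FM` by `M/N`. -/
noncomputable def gradingHom (F : Type*) [Field F] (N : Subgroup M) :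
    MonoidAlgebra F M →ₐ[F] MonoidAlgebra (MonoidAlgebra F M) (M ⧸ N) :=
  MonoidAlgebra.lift F _ M
    { toFun := fun m => MonoidAlgebra.single (m : M ⧸ N) (MonoidAlgebra.of F M m)
      map_one' := by rw [map_one]; rfl
      map_mul' := fun a b => by rw [MonoidAlgebra.single_mul_single, map_mul]; rfl }

theorem gradingHom_single (N : Subgroup M) (m : M) (r : F) :
    gradingHom F N (MonoidAlgebra.single m r) =
      MonoidAlgebra.single (m : M ⧸ N) (MonoidAlgebra.single m r) := by
  rw [gradingHom, MonoidAlgebra.lift_single]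
  change r • MonoidAlgebra.single (m : M ⧸ N) (MonoidAlgebra.of F M m) = _
  rw [MonoidAlgebra.smul_single, MonoidAlgebra.of_apply, MonoidAlgebra.smul_single, smul_eq_mul,
    mul_one]

theorem coeff_coeff_gradingHom (N : Subgroup M) (x : MonoidAlgebra F M) (m : M) :
    ((gradingHom F N x).coeff (m : M ⧸ N)).coeff m = x.coeff m := by
  classical
  induction x using MonoidAlgebra.induction_linear with
  | zero => simp
  | add x y hx hy =>
    rw [map_add, MonoidAlgebra.coeff_add, Finsupp.add_apply, MonoidAlgebra.coeff_add,
      Finsupp.add_apply, hx, hy, MonoidAlgebra.coeff_add, Finsupp.add_apply]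
  | single a r =>
    rw [gradingHom_single, MonoidAlgebra.coeff_single, MonoidAlgebra.coeff_single]
    by_cases h : a = m
    · subst h
      simp
    · rw [Finsupp.single_apply, Finsupp.single_eq_of_ne (Ne.symm h)]
      split_ifs <;> simp [Finsupp.single_eq_of_ne (Ne.symm h)]

theorem gradingHom_groupAlgebraMap (j : D →* M) (w : MonoidAlgebra F D) :
    gradingHom F j.range (groupAlgebraMap F j w) =
      MonoidAlgebra.single 1 (groupAlgebraMap F j w) := by
  induction w using MonoidAlgebra.induction_linear with
  | zero => simp
  | add x y hx hy => rw [map_add, map_add, hx, hy, MonoidAlgebra.single_add]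
  | single d r =>
    rw [groupAlgebraMap_single, gradingHom_single]
    congr 1
    exact (QuotientGroup.eq_one_iff _).2 ⟨d, rfl⟩

/-- A unit `u` of a reduced algebra `FM` with `u ^ k ∈ FD` lies in `FD`, if `M/D` is torsion-free:
its components of degree `a ≠ 1` in the grading by `M/D` lie in every prime ideal. -/
theorem exists_groupAlgebraMap_eq_of_pow [IsReduced (MonoidAlgebra F M)] {j : D →* M}
    (hj : Function.Injective j) (htf : IsTorsionFreeGroup (M ⧸ j.range))
    {u v : MonoidAlgebra F M} (huv : u * v = 1) {k : ℕ} (hk : k ≠ 0) {w : MonoidAlgebra F D}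
    (hw : groupAlgebraMap F j w = u ^ k) : ∃ w', groupAlgebraMap F j w' = u := by
  have hzero : ∀ a : M ⧸ j.range, a ≠ 1 → (gradingHom F j.range u).coeff a = 0 := by
    intro a ha
    -- It suffices to work modulo each prime ideal `I`, where the image of `u` is a trivial unit.
    refine IsNilpotent.eq_zero (nilpotent_iff_mem_prime.2 fun I hI => ?_)
    let q := Ideal.Quotient.mk I
    let φ := (MonoidAlgebra.mapRingHom (M ⧸ j.range) q).comp
      (gradingHom F j.range : MonoidAlgebra F M →+* _)
    have hφ : ∀ x, φ x = MonoidAlgebra.mapRingHom (M ⧸ j.range) q (gradingHom F j.range x) :=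
      fun x => rfl
    have hφuv : φ u * φ v = 1 := by rw [← map_mul, huv, map_one]
    obtain ⟨b, c, hbc⟩ := exists_eq_single_of_mul_eq_one htf hφuv
    have hc : c ≠ 0 := by
      rintro rfl
      rw [hbc, MonoidAlgebra.single_zero, zero_mul] at hφuv
      exact zero_ne_one hφuv
    have h1 : φ (u ^ k) = MonoidAlgebra.single (b ^ k) (c ^ k) := by
      rw [map_pow, hbc, MonoidAlgebra.single_pow]
    rw [hφ, ← hw, gradingHom_groupAlgebraMap, MonoidAlgebra.mapRingHom_single] at h1
    have hbk : b ^ k = 1 := by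
      rcases MonoidAlgebra.single_inj.1 h1 with h | h
      · exact h.1.symm
      · exact absurd h.2 (pow_ne_zero k hc)
    have hb : b = 1 :=
      htf b (isOfFinOrder_iff_pow_eq_one.2 ⟨k, Nat.pos_of_ne_zero hk, hbk⟩)
    have h2 := congrArg (fun y => MonoidAlgebra.coeff y a) hbc
    simp only [hφ, MonoidAlgebra.coeff_mapRingHom, MonoidAlgebra.coeff_single, hb,
      Finsupp.single_eq_of_ne ha] at h2
    exact Ideal.Quotient.eq_zero_iff_mem.1 h2
  refine ⟨MonoidAlgebra.comapDomain j hj u, MonoidAlgebra.mapDomain_comapDomain ?_ hj⟩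
  intro m hm
  by_contra hmj
  refine Finsupp.mem_support_iff.1 hm ?_
  rw [← coeff_coeff_gradingHom j.range u m, hzero, MonoidAlgebra.coeff_zero, Finsupp.zero_apply]
  exact fun h => hmj ((QuotientGroup.eq_one_iff m).1 h)

end Pure

/-- For `M` abelian without `p`-torsion and `M / j(D)` torsion-free, the quotient `V(FM) / V(FD)` is
torsion-free: the image of `V(FD)` in `V(FM)` is closed under taking roots. -/
theorem mem_range_normalizedUnitsMap_of_pow_mem {F D M : Type*} [Field F] [Group D] [Group M]
    (hM : ∀ a b : M, a * b = b * a) (p : ℕ) [Fact p.Prime] [CharP F p]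
    (hp : ∀ m : M, m ^ p = 1 → m = 1) {j : D →* M} (hj : Function.Injective j)
    (hpure : ∀ (m : M) (k : ℕ), k ≠ 0 → m ^ k ∈ j.range → m ∈ j.range)
    {u : normalizedUnits F M} {k : ℕ} (hk : k ≠ 0)
    (hu : u ^ k ∈ (normalizedUnitsMap F j).range) : u ∈ (normalizedUnitsMap F j).range := by
  let _ : CommGroup M := { ‹Group M› with mul_comm := hM }
  have : IsReduced (MonoidAlgebra F M) := isReduced_monoidAlgebra p hp
  have htf : IsTorsionFreeGroup (M ⧸ j.range) := by
    intro x hx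
    induction x using QuotientGroup.induction_on with | _ m => ?_
    obtain ⟨n, hn, hmn⟩ := isOfFinOrder_iff_pow_eq_one.1 hx
    rw [← QuotientGroup.mk_pow, QuotientGroup.eq_one_iff] at hmn
    exact (QuotientGroup.eq_one_iff m).2 (hpure m n hn.ne' hmn)
  have key : ∀ v : normalizedUnits F M, v ^ k ∈ (normalizedUnitsMap F j).range →
      ∃ w, groupAlgebraMap F j w = ((v : (MonoidAlgebra F M)ˣ) : MonoidAlgebra F M) := by
    rintro v ⟨w, hw⟩
    refine exists_groupAlgebraMap_eq_of_pow hj htf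
      (v := ((v : (MonoidAlgebra F M)ˣ)⁻¹ : (MonoidAlgebra F M)ˣ)) (Units.mul_inv _) hk
      (w := ((w : (MonoidAlgebra F D)ˣ) : MonoidAlgebra F D)) ?_
    rw [← coe_normalizedUnitsMap, hw]
    rfl
  obtain ⟨w, hw⟩ := key u hu
  obtain ⟨w', hw'⟩ := key u⁻¹ (by rw [inv_pow]; exact Subgroup.inv_mem _ hu)
  have hwu : IsUnit w := by
    refine ⟨⟨w, w', groupAlgebraMap_injective hj ?_, groupAlgebraMap_injective hj ?_⟩, rfl⟩
    · rw [map_mul, hw, hw', map_one]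
      exact Units.mul_inv (u : (MonoidAlgebra F M)ˣ)
    · rw [map_mul, hw, hw', map_one]
      exact Units.inv_mul (u : (MonoidAlgebra F M)ˣ)
  obtain ⟨v, hv⟩ := exists_normalizedUnits_of_isUnit hwu (by
    rw [← augmentationHom_groupAlgebraMap F j, hw, augmentation_normalizedUnits])
  exact ⟨v, normalizedUnits_coe_injective (by
    change groupAlgebraMap F j ((v : (MonoidAlgebra F D)ˣ) : MonoidAlgebra F D) = _
    rw [hv, hw])⟩

/-! ### The case where `FD` is a direct sum of fields -/

theorem exists_isDirectSumOfFields {F D : Type*} [Field F] [Group D] [Finite D]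
    (hD : ∀ a b : D, a * b = b * a) (p : ℕ) [Fact p.Prime] [CharP F p]
    (hp : ∀ d : D, d ^ p = 1 → d = 1) : ∃ n, IsDirectSumOfFields (MonoidAlgebra F D) n := by
  let _ : CommGroup D := { ‹Group D› with mul_comm := hD }
  have : IsReduced (MonoidAlgebra F D) := isReduced_monoidAlgebra p hp
  have : IsArtinianRing (MonoidAlgebra F D) := IsArtinianRing.of_finite F _
  let e := Finite.equivFin (MaximalSpectrum (MonoidAlgebra F D))
  exact ⟨_, fun i => MonoidAlgebra F D ⧸ (e.symm i).asIdeal,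
    fun i => Ideal.Quotient.field _,
    ⟨(IsArtinianRing.equivPi (MonoidAlgebra F D)).toRingEquiv.trans
      (RingEquiv.piCongrLeft' (fun I : MaximalSpectrum (MonoidAlgebra F D) =>
        MonoidAlgebra F D ⧸ I.asIdeal) e)⟩⟩

theorem bijective_monoidAlgebra_pi {ι A : Type*} [Finite ι] [Group A] (K : ι → Type*)
    [∀ i, Field (K i)] :
    Function.Bijective (RingHom.pi fun i => MonoidAlgebra.mapRingHom A (Pi.evalRingHom K i)) := by
  classical
  have := Fintype.ofFinite ι
  constructor
  · intro x y hxy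
    refine MonoidAlgebra.coeff_injective (Finsupp.ext fun a => funext fun i => ?_)
    exact DFunLike.congr_fun (congrArg MonoidAlgebra.coeff (congrFun hxy i)) a
  · intro y
    refine ⟨.ofCoeff (Finsupp.onFinset (Finset.univ.biUnion fun i => (y i).coeff.support)
      (fun a i => (y i).coeff a) fun a ha => ?_), funext fun i => ?_⟩
    · obtain ⟨i, hi⟩ := Function.ne_iff.1 ha
      exact Finset.mem_biUnion.2 ⟨i, Finset.mem_univ i, Finsupp.mem_support_iff.2 hi⟩
    · exact MonoidAlgebra.coeff_injective (Finsupp.ext fun a => rfl)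

section Splitting

variable {F D A ι : Type*} [Field F] [Group D] [Group A] [Finite ι] {K : ι → Type*}
  [∀ i, Field (K i)]

/-- The isomorphism `F[A × D] ≅ (FD)[A] ≅ ∏ K_i[A]` obtained from `FD ≅ ∏ K_i`. -/
noncomputable def prodRingEquiv (A : Type*) [Group A] (E : MonoidAlgebra F D ≃+* ∀ i, K i) :
    MonoidAlgebra F (A × D) ≃+* ∀ i, MonoidAlgebra (K i) A :=
  (MonoidAlgebra.curryRingEquiv.trans (MonoidAlgebra.mapRingEquiv A E)).trans
    (RingEquiv.ofBijective _ (bijective_monoidAlgebra_pi K))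

theorem prodRingEquiv_single (E : MonoidAlgebra F D ≃+* ∀ i, K i) (a : A) (d : D) (r : F) (i : ι) :
    prodRingEquiv A E (MonoidAlgebra.single (a, d) r) i =
      MonoidAlgebra.single a (E (MonoidAlgebra.single d r) i) := by
  simp only [prodRingEquiv, RingEquiv.trans_apply, MonoidAlgebra.curryRingEquiv_single,
    MonoidAlgebra.mapRingEquiv_single, RingEquiv.ofBijective_apply]
  exact MonoidAlgebra.mapRingHom_single (Pi.evalRingHom K i) a _

theorem augmentationHom_prodRingEquiv (E : MonoidAlgebra F D ≃+* ∀ i, K i)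
    (x : MonoidAlgebra F (A × D)) (i : ι) :
    augmentationHom (K i) A (prodRingEquiv A E x i) =
      E (groupAlgebraMap F (MonoidHom.snd A D) x) i := by
  induction x using MonoidAlgebra.induction_linear with
  | zero => simp
  | add x y hx hy => simp only [map_add, Pi.add_apply, hx, hy]
  | single m r =>
    obtain ⟨a, d⟩ := m
    rw [prodRingEquiv_single, groupAlgebraMap_single]
    simp [augmentationHom]

/-- If `FD ≅ ∏ K_i` is a product of fields and `A` is torsion-free abelian, then a unit of
`F[A × D] ≅ ∏ K_i[A]` is given by its coefficient and its degree in each factor. -/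
theorem nonempty_normalizedUnits_prod_equiv (hA : ∀ a b : A, a * b = b * a)
    (hAt : IsTorsionFreeGroup A) (E : MonoidAlgebra F D ≃+* ∀ i, K i) :
    Nonempty (normalizedUnits F (A × D) ≃* normalizedUnits F D × (ι → A)) := by
  let _ : CommGroup A := { ‹Group A› with mul_comm := hA }
  let Φ := prodRingEquiv A E
  let U : ∀ i, normalizedUnits F (A × D) →* (MonoidAlgebra (K i) A)ˣ := fun i =>
    (Units.map ((Pi.evalRingHom (fun i => MonoidAlgebra (K i) A) i).comp
      Φ.toRingHom).toMonoidHom).comp (normalizedUnits F (A × D)).subtype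
  let δ : ∀ i, normalizedUnits F (A × D) →* A := fun i => (unitDegreeHom hAt).comp (U i)
  have hδ : ∀ i (u : normalizedUnits F (A × D)), ∃ c,
      Φ ((u : (MonoidAlgebra F (A × D))ˣ) : MonoidAlgebra F (A × D)) i =
        MonoidAlgebra.single (δ i u) c := fun i u => eq_single_unitDegree hAt (U i u)
  let Θ : normalizedUnits F (A × D) →* normalizedUnits F D × (ι → A) :=
    (normalizedUnitsMap F (MonoidHom.snd A D)).prod (MonoidHom.pi δ)
  refine ⟨MulEquiv.ofBijective Θ ⟨?_, ?_⟩⟩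
  · rw [injective_iff_map_eq_one]
    intro u hu
    have hu1 : normalizedUnitsMap F (MonoidHom.snd A D) u = 1 := congrArg Prod.fst hu
    have hu2 : ∀ i, δ i u = 1 := fun i => congrFun (congrArg Prod.snd hu) i
    refine normalizedUnits_coe_injective (Φ.injective (funext fun i => ?_))
    obtain ⟨c, hc⟩ := hδ i u
    have h := augmentationHom_prodRingEquiv E
      ((u : (MonoidAlgebra F (A × D))ˣ) : MonoidAlgebra F (A × D)) i
    rw [← coe_normalizedUnitsMap, hu1] at h
    change augmentationHom (K i) A (Φ _ i) = E 1 i at h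
    rw [hc, map_one, Pi.one_apply] at h
    have hc1 : c = 1 := by simpa [augmentationHom] using h
    change Φ ((u : (MonoidAlgebra F (A × D))ˣ) : MonoidAlgebra F (A × D)) i = Φ 1 i
    rw [hc, hu2, hc1, map_one]
    rfl
  · rintro ⟨v, a⟩
    let w : ∀ i, MonoidAlgebra (K i) A := fun i =>
      MonoidAlgebra.single (a i) (E ((v : (MonoidAlgebra F D)ˣ) : MonoidAlgebra F D) i)
    let w' : ∀ i, MonoidAlgebra (K i) A := fun i =>
      MonoidAlgebra.single (a i)⁻¹
        (E (((v : (MonoidAlgebra F D)ˣ)⁻¹ : (MonoidAlgebra F D)ˣ) : MonoidAlgebra F D) i)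
    have hww' : w * w' = 1 := by
      funext i
      change w i * w' i = 1
      simp only [w, w']
      rw [MonoidAlgebra.single_mul_single, mul_inv_cancel, ← Pi.mul_apply, ← map_mul,
        Units.mul_inv, map_one]
      rfl
    have hunit : IsUnit (Φ.symm w) := (IsUnit.of_mul_eq_one w' hww').map Φ.symm
    have hsnd : groupAlgebraMap F (MonoidHom.snd A D) (Φ.symm w) =
        ((v : (MonoidAlgebra F D)ˣ) : MonoidAlgebra F D) := by
      refine E.injective (funext fun i => ?_)
      rw [← augmentationHom_prodRingEquiv]
      change augmentationHom (K i) A (Φ (Φ.symm w) i) = _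
      rw [RingEquiv.apply_symm_apply]
      simp [w, augmentationHom]
    obtain ⟨u, hu⟩ := exists_normalizedUnits_of_isUnit hunit (by
      rw [← augmentationHom_groupAlgebraMap F (MonoidHom.snd A D), hsnd,
        augmentation_normalizedUnits])
    refine ⟨u, Prod.ext (normalizedUnits_coe_injective ?_) (funext fun i => ?_)⟩
    · change groupAlgebraMap F (MonoidHom.snd A D)
        ((u : (MonoidAlgebra F (A × D))ˣ) : MonoidAlgebra F (A × D)) = _
      rw [hu, hsnd]
    · refine unitDegree_eq hAt (c := E ((v : (MonoidAlgebra F D)ˣ) : MonoidAlgebra F D) i) ?_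
      change Φ ((u : (MonoidAlgebra F (A × D))ˣ) : MonoidAlgebra F (A × D)) i = _
      rw [hu, RingEquiv.apply_symm_apply]

end Splitting

theorem nonempty_normalizedUnits_congr {F G H : Type*} [Field F] [Group G] [Group H] (e : G ≃* H) :
    Nonempty (normalizedUnits F G ≃* normalizedUnits F H) := by
  refine ⟨MulEquiv.ofBijective (normalizedUnitsMap F e.toMonoidHom)
    ⟨normalizedUnitsMap_injective e.injective,
      normalizedUnitsMap_surjective e.surjective fun x hx => ?_⟩⟩
  rw [mem_subgroupIdeal_ker_iff] at hx
  rw [groupAlgebraMap_injective e.injective (hx.trans (map_zero _).symm)]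
  exact IsNilpotent.zero

/-! ### Structure of `V(FG)` and of the torsion part of `G` -/

theorem theorem2 {F G : Type*} [Field F] [Group G] (p : ℕ) [Fact p.Prime] [CharP F p]
    (hG'p : IsPGroup p (commutator G)) (hG'fin : IsLocallyFiniteGroup (commutator G))
    (P : Sylow p G) [(P : Subgroup G).Normal]
    (hV : IsEngelGroup (normalizedUnits F G)) :
    -- (i)
    (commutator (normalizedUnits F G) ≤ onePlus (subgroupIdeal F (commutator G)) ∧
      (∀ x ∈ subgroupIdeal F (P : Subgroup G), ∃ u : normalizedUnits F G,
        ((u : (MonoidAlgebra F G)ˣ) : MonoidAlgebra F G) = 1 + x) ∧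
      (∀ S : Sylow p (normalizedUnits F G),
        (S : Subgroup (normalizedUnits F G)) = onePlus (subgroupIdeal F (P : Subgroup G)))) ∧
    -- (ii)
    (∀ q : ℕ, q.Prime → q ≠ p →
      (∀ Q : Sylow q G, (Q : Subgroup G) = syl q G) ∧ syl q G ≤ Subgroup.center G) ∧
    -- `D` is the internal direct product of the (central) groups `syl q G`, `q ≠ p`
    iSupIndep (fun q : {q : ℕ // q.Prime ∧ q ≠ p} => syl (q : ℕ) G) ∧
    -- (iv)
    (Nonempty ((normalizedUnits F G ⧸ onePlus (subgroupIdeal F (P : Subgroup G))) ≃*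
        normalizedUnits F (subgroupM p (P : Subgroup G))) ∧
      Function.Injective (normalizedUnitsMap F (primeToPartHom p (P : Subgroup G))) ∧
      ∃ _ : (normalizedUnitsMap F (primeToPartHom p (P : Subgroup G))).range.Normal,
        IsTorsionFreeGroup (normalizedUnits F (subgroupM p (P : Subgroup G)) ⧸
          (normalizedUnitsMap F (primeToPartHom p (P : Subgroup G))).range)) ∧
    -- (iii) and (v): the torsion part `T` of `G` is a normal subgroup
    ∃ (T : Subgroup G) (_ : T.Normal),
      (T : Set G) = {g | IsOfFinOrder g} ∧
      (T = (P : Subgroup G) ⊔ primeToPart p G ∧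
        Disjoint (P : Subgroup G) (primeToPart p G) ∧
        (∀ x ∈ (P : Subgroup G), ∀ y ∈ primeToPart p G, Commute x y)) ∧
      (∀ a b : G ⧸ T, a * b = b * a) ∧
      IsTorsionFreeGroup (G ⧸ T) ∧
      (Finite (primeToPart p G) →
        (∃ n : ℕ, IsDirectSumOfFields (MonoidAlgebra F (primeToPart p G)) n) ∧
        ∀ n : ℕ, IsDirectSumOfFields (MonoidAlgebra F (primeToPart p G)) n →
          Nonempty (normalizedUnits F (subgroupM p (P : Subgroup G)) ≃*
            (normalizedUnits F (primeToPart p G) × (Fin n → G ⧸ T)))) := by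
  let D := primeToPart p G
  let M := subgroupM p (P : Subgroup G)
  have hp : p.Prime := Fact.out
  have hE : IsEngelGroup G :=
    hV.of_injective (groupToNormalizedUnits F G) groupToNormalizedUnits_injective
  have hc : ∀ (g : G) (m : ℕ), g ^ m = 1 → m.Coprime p → g ∈ Subgroup.center G :=
    fun g m hg hm => mem_center_of_coprime hE hG'p hg hm
  have hGP : commutator G ≤ P := IsPGroup.le_of_normal_sylow hG'p
  have hPfin : ∀ x ∈ (P : Subgroup G), IsOfFinOrder x := fun x hx =>
    (mem_sylow_sup_primeToPart_iff (P := P) hc).1 (Subgroup.mem_sup_left hx)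
  have hnil : ∀ x ∈ subgroupIdeal F (P : Subgroup G), IsNilpotent x := fun x hx =>
    isNilpotent_of_mem_subgroupIdeal F hE P.isPGroup' hGP
      (fun S hS hSP => finite_closure_of_commutator_le hG'fin hPfin hS hSP) hx
  -- `M` is the whole of `G / P`, an abelian group without `p`-torsion.
  have hMtop : subgroupM p (P : Subgroup G) = ⊤ := subgroupM_eq_top hc
  let f : G →* M := (QuotientGroup.mk' (P : Subgroup G)).codRestrict M fun g => by
    simp only [M, hMtop, Subgroup.mem_top]
  have hf : Function.Surjective f := by
    rintro ⟨x, hx⟩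
    obtain ⟨g, rfl⟩ := QuotientGroup.mk'_surjective _ x
    exact ⟨g, rfl⟩
  have hfker : ∀ g, f g = 1 ↔ g ∈ (P : Subgroup G) := fun g =>
    Subtype.ext_iff.trans (QuotientGroup.eq_one_iff g)
  have hfker' : f.ker = P := Subgroup.ext fun g => hfker g
  have hnil' : ∀ x ∈ subgroupIdeal F f.ker, IsNilpotent x := hfker'.symm ▸ hnil
  have hMcomm : ∀ a b : M, a * b = b * a := by
    intro a b
    obtain ⟨x, rfl⟩ := hf a
    obtain ⟨y, rfl⟩ := hf b
    rw [← commutatorElement_eq_one_iff_mul_comm, ← map_commutatorElement, hfker]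
    exact hGP (Subgroup.commutator_mem_commutator (Subgroup.mem_top x) (Subgroup.mem_top y))
  have hMp : ∀ m : M, m ^ p = 1 → m = 1 := by
    intro m hm
    obtain ⟨x, rfl⟩ := hf m
    rw [← map_pow, hfker] at hm
    obtain ⟨k, hk⟩ := P.isPGroup' ⟨_, hm⟩
    rw [hfker]
    refine mem_sylow_of_pow_eq_one (k := k + 1) ?_
    rw [pow_succ', pow_mul]
    exact congrArg Subtype.val hk
  -- The image of `D` in `M` is the torsion subgroup of `M`.
  let j : D →* M := primeToPartHom p (P : Subgroup G)
  have hjf : ∀ d : D, j d = f d := fun d => rfl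
  have hPD : Disjoint (P : Subgroup G) D := disjoint_sylow_primeToPart hc
  have hj : Function.Injective j := by
    rw [injective_iff_map_eq_one]
    intro d hd
    rw [hjf, hfker] at hd
    exact Subtype.ext (Subgroup.disjoint_def.1 hPD hd d.2)
  have hjmem : ∀ x : G, f x ∈ j.range ↔ IsOfFinOrder x := by
    intro x
    rw [← mem_sylow_sup_primeToPart_iff (P := P) hc]
    constructor
    · rintro ⟨d, hd⟩
      rw [hjf, ← mul_inv_eq_one, ← map_inv, ← map_mul, hfker] at hd
      have h1 := Subgroup.mul_mem _ (Subgroup.inv_mem _ (Subgroup.mem_sup_left hd))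
        (Subgroup.mem_sup_right d.2 : (d : G) ∈ (P : Subgroup G) ⊔ D)
      simpa using h1
    · intro hx
      obtain ⟨a, ha, d, hd, rfl⟩ := Subgroup.mem_sup_of_normal_left.1 hx
      exact ⟨⟨d, hd⟩, by rw [hjf, map_mul, (hfker a).2 ha, one_mul]⟩
  have hpure : ∀ (m : M) (k : ℕ), k ≠ 0 → m ^ k ∈ j.range → m ∈ j.range := by
    intro m k hk hm
    obtain ⟨x, rfl⟩ := hf m
    rw [← map_pow, hjmem] at hm
    exact (hjmem x).2 (hm.of_pow hk)
  have hVcomm := normalizedUnits_mul_comm (F := F) hMcomm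
  have hRn : (normalizedUnitsMap F (primeToPartHom p (P : Subgroup G))).range.Normal :=
    ⟨fun n hn g => by rwa [hVcomm g n, mul_inv_cancel_right]⟩
  let T : Subgroup G := (P : Subgroup G) ⊔ D
  have hDn : D.Normal := ⟨fun d hd g => by
    rwa [Subgroup.mem_center_iff.1 (primeToPart_le_center hc hd) g, mul_inv_cancel_right]⟩
  have hTn : T.Normal := Subgroup.sup_normal _ _
  have hTcomm : ∀ a b : G ⧸ T, a * b = b * a := by
    intro a b
    obtain ⟨x, rfl⟩ := QuotientGroup.mk'_surjective _ a
    obtain ⟨y, rfl⟩ := QuotientGroup.mk'_surjective _ b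
    rw [← commutatorElement_eq_one_iff_mul_comm, ← map_commutatorElement]
    exact (QuotientGroup.eq_one_iff _).2 (Subgroup.mem_sup_left
      (hGP (Subgroup.commutator_mem_commutator (Subgroup.mem_top x) (Subgroup.mem_top y))))
  have hTtf : IsTorsionFreeGroup (G ⧸ T) := by
    intro a ha
    obtain ⟨x, rfl⟩ := QuotientGroup.mk'_surjective _ a
    obtain ⟨n, hn, hxn⟩ := isOfFinOrder_iff_pow_eq_one.1 ha
    rw [← map_pow] at hxn
    have hxn' := (mem_sylow_sup_primeToPart_iff hc).1 ((QuotientGroup.eq_one_iff _).1 hxn)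
    exact (QuotientGroup.eq_one_iff _).2
      ((mem_sylow_sup_primeToPart_iff hc).2 (hxn'.of_pow hn.ne'))
  refine ⟨⟨commutator_normalizedUnits_le, fun x hx => ?_, fun S => ?_⟩, fun q hq hqp => ⟨fun Q =>
    sylow_eq_syl (pow_prime_central hc hq hqp) Q, syl_le_center hc hq hqp⟩, iSupIndep_syl hc,
    ⟨nonempty_quotient_onePlus_equiv hf hnil' hfker', normalizedUnitsMap_injective hj, hRn, ?_⟩,
    T, hTn, ?_, ⟨rfl, hPD, ?_⟩, hTcomm, hTtf, fun hDfin => ⟨?_, ?_⟩⟩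
  · rw [← hfker'] at hx
    exact exists_normalizedUnits_eq_one_add f hnil' hx
  · -- A `p`-element of `V(FG)` becomes trivial in `V(FM)`, because `FM` is reduced.
    have hle : (S : Subgroup (normalizedUnits F G)) ≤
        onePlus (subgroupIdeal F (P : Subgroup G)) := by
      intro u hu
      obtain ⟨k, hk⟩ := S.isPGroup' ⟨u, hu⟩
      have hk' : u ^ p ^ k = 1 := congrArg Subtype.val hk
      have hgoal : u ∈ (normalizedUnitsMap F f).ker := by
        have h1 : normalizedUnitsMap F f u ^ p ^ k = 1 := by rw [← map_pow, hk', map_one]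
        exact eq_one_of_pow_prime_pow_eq_one hMcomm hMp h1
      rwa [ker_normalizedUnitsMap, hfker'] at hgoal
    exact (S.is_maximal' (isPGroup_onePlus hnil) hle).symm
  · intro x hx
    induction x using QuotientGroup.induction_on with | _ u => ?_
    obtain ⟨k, hk, huk⟩ := isOfFinOrder_iff_pow_eq_one.1 hx
    rw [← QuotientGroup.mk_pow, QuotientGroup.eq_one_iff] at huk
    exact (QuotientGroup.eq_one_iff u).2
      (mem_range_normalizedUnitsMap_of_pow_mem hMcomm p hMp hj hpure hk.ne' huk)
  · exact Set.ext fun g => mem_sylow_sup_primeToPart_iff hc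
  · exact fun x _ y hy => Subgroup.mem_center_iff.1 (primeToPart_le_center hc hy) x
  · refine exists_isDirectSumOfFields
      (fun a b => Subtype.ext (Subgroup.mem_center_iff.1 (primeToPart_le_center hc b.2) a)) p
      fun d hd => hj ?_
    rw [map_one]
    exact hMp _ (by rw [← map_pow, hd, map_one])
  · rintro n ⟨K, _, ⟨E⟩⟩
    let π : M →* G ⧸ T :=
      (QuotientGroup.map (P : Subgroup G) T (MonoidHom.id G) le_sup_left).comp M.subtype
    have hπf : ∀ x : G, π (f x) = x := fun x => rfl
    have hπ : Function.Surjective π := by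
      intro a
      obtain ⟨x, rfl⟩ := QuotientGroup.mk'_surjective _ a
      exact ⟨f x, rfl⟩
    have hπj : π.ker = j.range := by
      ext m
      obtain ⟨x, rfl⟩ := hf m
      rw [MonoidHom.mem_ker, hπf, QuotientGroup.eq_one_iff, hjmem]
      exact mem_sylow_sup_primeToPart_iff hc
    obtain ⟨e⟩ := nonempty_equiv_prod_of_finite hMcomm hj hpure hπ hπj
    obtain ⟨e₁⟩ := nonempty_normalizedUnits_congr (F := F) e
    obtain ⟨e₂⟩ := nonempty_normalizedUnits_prod_equiv hTcomm hTtf E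
    exact ⟨e₁.trans e₂⟩
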